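/- **Definitions.** Graphs are finite and simple. For a digraph $H=(V,E)$ and $S\subseteq V$, a *multimove* of $S$ is a map $f$ that is injective on $S$ and satisfies $f(x)=x$ or $(x,f(x))\in E$ for every $x\in S$. Let $MEDS(H)$ be the greatest family of subsets of $V$ such that for every $S\in MEDS(H)$ and every $r\in V\setminus S$ there is a multimove $f$ of $S$ with $r\in f(S)$ and $f(S)\in MEDS(H)$. Put $\gamma^\infty_m(H)=\min\{|S| : S\in MEDS(H)\}$. For an undirected graph $G$, the *oriented m-eternal domination number* is $\overrightarrow{\gamma^\infty_m}(G)=\min\{\gamma^\infty_m(H) : H \text{ is an orientation of } G\}$, where an orientation assigns exactly one direction to each edge of $G$. A graph is *trivially perfect* if each of its connected induced subgraphs has a universal vertex. A graph is *2-vertex-connected* if it is connected and stays connected when any one vertex is removed (so $K_2$ is 2-vertex-connected); the *2-vertex-connected components* of $G$ are the subgraphs induced by the maximal vertex sets that induce a 2-vertex-connected subgraph, and the size of a component is its number of vertices. **Theorem.** Let $G$ be a connected trivially perfect graph with at least two vertices and with exactly $l$ 2-vertex-connected components. 1. If $G$ has exactly one 2-vertex-connected component $G_i$ of size at least $3$,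 then $\overrightarrow{\gamma^\infty_m}(G)=\overrightarrow{\gamma^\infty_m}(G_i)+l-1$, and $\overrightarrow{\gamma^\infty_m}(G_i)\le 3$. 2. If every 2-vertex-connected component of $G$ has size at most $3$, then $\overrightarrow{\gamma^\infty_m}(G)=l+1$. 3. If $G$ has two distinct 2-vertex-connected components, one of size at least $4$ and the other of size at least $3$, then $\overrightarrow{\gamma^\infty_m}(G)=l+2$. Moreover, $\overrightarrow{\gamma^\infty_m}$ can be computed in linear time on trivially perfect graphs: there are a program for a random access machine (unit cost per step, with copying, successor and comparison of natural numbers and indexed memory access as its operations) and a constant $C$ such that, for every trivially perfect graph $G$ (connected or not) with vertex set $\{0,\dots,n-1\}$ and $m$ edges, given by its adjacency lists in any order, the program halts after at most $C\,(n+m+1)$ steps with output $\overrightarrow{\gamma^\infty_m}(G)$. -/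

import Mathlib

namespace EternalDomination

/-! ### m-eternal domination on digraphs and oriented m-eternal domination -/

section Eternal

variable {V : Type*}

/-- `f` is a multimove of the guards standing on `S` along the arcs of `H`: distinct guards go to
distinct vertices, and each guard stays where it is or moves along an arc. The new set of guards
is `f '' S`. -/
def IsMultimove (H : Digraph V) (S : Set V) (f : V → V) : Prop :=
  Set.InjOn f S ∧ ∀ x ∈ S, f x = x ∨ H.Adj x (f x)

/-- A family `F` of guard sets is closed under defense if from every `S ∈ F` every attack on an
unguarded vertex can be answered by a multimove that leads to a member of `F`. -/
def ClosedUnderDefense (H : Digraph V) (F : Set (Set V)) : Prop :=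
  ∀ S ∈ F, ∀ r, r ∉ S → ∃ f : V → V, IsMultimove H S f ∧ r ∈ f '' S ∧ f '' S ∈ F

/-- The m-eternal dominating sets of `H`: the greatest family that is closed under defense, that
is, the union of all such families. -/
def MEDS (H : Digraph V) : Set (Set V) :=
  ⋃₀ {F | ClosedUnderDefense H F}

/-- The m-eternal domination number of a digraph on a finite vertex set: the least size of an
m-eternal dominating set. (The whole vertex set always is one.) -/
noncomputable def mEternalNumber (H : Digraph V) : ℕ :=
  sInf {k | ∃ S ∈ MEDS H, S.ncard = k}

/-- `H` is an orientation of `G`: every edge of `G` gets exactly one of its two directions, and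
there are no other arcs. -/
def IsOrientation (G : SimpleGraph V) (H : Digraph V) : Prop :=
  (∀ u v, G.Adj u v ↔ H.Adj u v ∨ H.Adj v u) ∧ ∀ u v, ¬ (H.Adj u v ∧ H.Adj v u)

/-- The oriented m-eternal domination number of a graph on a finite vertex set: the minimum of the
m-eternal domination numbers of its orientations. -/
noncomputable def orientedMEternalNumber (G : SimpleGraph V) : ℕ :=
  sInf {k | ∃ H : Digraph V, IsOrientation G H ∧ mEternalNumber H = k}

/-- The family `MEDS H` is itself closed under defense, hence it is the greatest such family. -/
theorem closedUnderDefense_MEDS (H : Digraph V) : ClosedUnderDefense H (MEDS H) := by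
  rintro S ⟨F, hF, hS⟩ r hr
  obtain ⟨f, hf, hrf, hfF⟩ := hF S hS r hr
  exact ⟨f, hf, hrf, F, hF, hfF⟩

/-! ### Trivially perfect graphs and 2-vertex-connected components -/

/-- A graph is trivially perfect if every connected induced subgraph has a universal vertex. -/
def IsTriviallyPerfect (G : SimpleGraph V) : Prop :=
  ∀ S : Set V, (G.induce S).Connected → ∃ u, (G.induce S).IsUniversal u

/-- A graph is `k`-vertex-connected if it is connected and stays connected when any set of at most
`k - 1` vertices is removed. -/
def IsVertexConnected (k : ℕ) (G : SimpleGraph V) : Prop :=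
  G.Connected ∧ ∀ S : Set V, S.Finite → S.ncard ≤ k - 1 → (G.induce Sᶜ).Preconnected

/-- The 2-vertex-connected components of `G`, given by their vertex sets: the maximal vertex sets
that induce a 2-vertex-connected subgraph. -/
def twoVertexConnectedComponents (G : SimpleGraph V) : Set (Set V) :=
  {B | Maximal (fun B : Set V => IsVertexConnected 2 (G.induce B)) B}

end Eternal

/-! ### Linear time on a random access machine

The machine has registers and arrays (finitely many of each occur in a program), all holding
natural numbers, with random access into the arrays. Every assignment and every evaluation of a
test costs one time unit. The only arithmetic is the successor, so that after `t` steps no stored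
number exceeds, by more than `t`, the largest number that occurs in the input or in the program. -/

/-- Programs of the machine. `x`, `y`, `i` are names of registers and `a` is the name of an
array. -/
inductive Program : Type
  /-- `x := c` for a literal `c` -/
  | const (x c : ℕ) : Program
  /-- `x := y` -/
  | copy (x y : ℕ) : Program
  /-- `x := x + 1` -/
  | incr (x : ℕ) : Program
  /-- `x := a[i]` -/
  | load (x a i : ℕ) : Program
  /-- `a[i] := x` -/
  | store (a i x : ℕ) : Program
  /-- first `p`, then `q` -/
  | seq (p q : Program) : Program
  /-- if `x < y` then `p` else `q` -/
  | ifLT (x y : ℕ) (p q : Program) : Program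
  /-- while `x < y` do `p` -/
  | whileLT (x y : ℕ) (p : Program) : Program

/-- A state of the machine: the contents of the registers and of the arrays. -/
structure State : Type where
  /-- the content of each register -/
  reg : ℕ → ℕ
  /-- the content of each cell of each array -/
  arr : ℕ → ℕ → ℕ

/-- The state after writing `c` into the register `x`. -/
def State.setReg (s : State) (x c : ℕ) : State :=
  { s with reg := Function.update s.reg x c }

/-- The state after writing `c` into the cell `i` of the array `a`. -/
def State.setArr (s : State) (a i c : ℕ) : State :=
  { s with arr := Function.update s.arr a (Function.update (s.arr a) i c) }

/-- `Exec p s s' t`: the program `p`, started in the state `s`, halts in the state `s'` after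
exactly `t` steps. -/
inductive Exec : Program → State → State → ℕ → Prop
  | const (s : State) (x c : ℕ) : Exec (.const x c) s (s.setReg x c) 1
  | copy (s : State) (x y : ℕ) : Exec (.copy x y) s (s.setReg x (s.reg y)) 1
  | incr (s : State) (x : ℕ) : Exec (.incr x) s (s.setReg x (s.reg x + 1)) 1
  | load (s : State) (x a i : ℕ) :
      Exec (.load x a i) s (s.setReg x (s.arr a (s.reg i))) 1
  | store (s : State) (a i x : ℕ) :
      Exec (.store a i x) s (s.setArr a (s.reg i) (s.reg x)) 1
  | seq {p q : Program} {s s' s'' : State} {t t' : ℕ} :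
      Exec p s s' t → Exec q s' s'' t' → Exec (.seq p q) s s'' (t + t')
  | ifTrue {x y : ℕ} {p q : Program} {s s' : State} {t : ℕ} :
      s.reg x < s.reg y → Exec p s s' t → Exec (.ifLT x y p q) s s' (t + 1)
  | ifFalse {x y : ℕ} {p q : Program} {s s' : State} {t : ℕ} :
      ¬ s.reg x < s.reg y → Exec q s s' t → Exec (.ifLT x y p q) s s' (t + 1)
  | whileTrue {x y : ℕ} {p : Program} {s s' s'' : State} {t t' : ℕ} :
      s.reg x < s.reg y → Exec p s s' t → Exec (.whileLT x y p) s' s'' t' →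
      Exec (.whileLT x y p) s s'' (t + t' + 1)
  | whileFalse {x y : ℕ} {p : Program} {s : State} :
      ¬ s.reg x < s.reg y → Exec (.whileLT x y p) s s 1

/-- The machine is deterministic: the final state and the number of steps are determined by the
program and the initial state. -/
theorem Exec.unique {p : Program} {s s₁ s₂ : State} {t₁ t₂ : ℕ}
    (h₁ : Exec p s s₁ t₁) (h₂ : Exec p s s₂ t₂) : s₁ = s₂ ∧ t₁ = t₂ := by
  induction h₁ generalizing s₂ t₂ with
  | const | copy | incr | load | store => cases h₂; exact ⟨rfl, rfl⟩
  | seq _ _ ih₁ ih₂ =>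
    cases h₂ with
    | seq h h' =>
      obtain ⟨rfl, rfl⟩ := ih₁ h
      obtain ⟨rfl, rfl⟩ := ih₂ h'
      exact ⟨rfl, rfl⟩
  | ifTrue hc _ ih =>
    cases h₂ with
    | ifTrue _ h => obtain ⟨rfl, rfl⟩ := ih h; exact ⟨rfl, rfl⟩
    | ifFalse hc' _ => exact absurd hc hc'
  | ifFalse hc _ ih =>
    cases h₂ with
    | ifFalse _ h => obtain ⟨rfl, rfl⟩ := ih h; exact ⟨rfl, rfl⟩
    | ifTrue hc' _ => exact absurd hc' hc
  | whileTrue hc _ _ ih₁ ih₂ =>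
    cases h₂ with
    | whileTrue _ h h' =>
      obtain ⟨rfl, rfl⟩ := ih₁ h
      obtain ⟨rfl, rfl⟩ := ih₂ h'
      exact ⟨rfl, rfl⟩
    | whileFalse hc' => exact absurd hc hc'
  | whileFalse hc =>
    cases h₂ with
    | whileTrue hc' _ _ => exact absurd hc' hc
    | whileFalse _ => exact ⟨rfl, rfl⟩

/-- The state `s` is an initial state that represents the graph `G` on the vertices
`0, …, n - 1` by adjacency lists, in any order. The register `0` holds `n`. The list of the
neighbors of `v`, without repetition, is the segment of the array `1` from the position `off v` to
the position `off (v + 1) - 1`, where `off` is the array `0`. These lists are stored one after the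
other, beginning at the position `0`. All other memory is `0`. -/
structure IsAdjacencyListInput {n : ℕ} (G : SimpleGraph (Fin n)) (s : State) : Prop where
  order : s.reg 0 = n
  reg_other : ∀ x, x ≠ 0 → s.reg x = 0
  offset_zero : s.arr 0 0 = 0
  offset_mono : ∀ v : Fin n, s.arr 0 v ≤ s.arr 0 (v + 1)
  offset_end : ∀ i, n < i → s.arr 0 i = 0
  neighbors : ∀ v : Fin n, Set.BijOn (s.arr 1) (Set.Ico (s.arr 0 v) (s.arr 0 (v + 1)))
    ((fun w : Fin n => (w : ℕ)) '' G.neighborSet v)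
  neighbors_end : ∀ j, s.arr 0 n ≤ j → s.arr 1 j = 0
  arr_other : ∀ a, 2 ≤ a → ∀ i, s.arr a i = 0

/-- The graph parameter `φ` can be computed in linear time on the graph class `𝒞`: there are one
program and one constant `C` such that on every adjacency list representation of every graph of
the class, with `n` vertices and `m` edges, the program halts after at most `C * (n + m + 1)`
steps with the value of `φ` in the register `0`. -/
def ComputableInLinearTimeOn (𝒞 : ∀ n : ℕ, SimpleGraph (Fin n) → Prop)
    (φ : ∀ n : ℕ, SimpleGraph (Fin n) → ℕ) : Prop :=
  ∃ (p : Program) (C : ℕ), ∀ (n : ℕ) (G : SimpleGraph (Fin n)), 𝒞 n G →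
    ∀ s : State, IsAdjacencyListInput G s →
      ∃ (s' : State) (t : ℕ), Exec p s s' t ∧ t ≤ C * (n + G.edgeSet.ncard + 1) ∧
        s'.reg 0 = φ n G

end EternalDomination

/-! A connected trivially perfect graph has a universal vertex `u`. Its 2-vertex-connected
components are `u` together with one of the parts, that is, the components of `G - u`; so `l` is the
number of parts, and guards change parts only through `u`.

At least `l + 1` guards are needed (`IsCone.card_add_one_le`). A part never loses its last guard: if
it did, a later attack there could only be answered from `u`, so all its arcs would come from `u`,
whereas the guard that left used an arc to `u`. Hence all parts can be forced to be guarded, and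
then `u` as well. Conversely, every part has a universal vertex `v i`, and orienting triangles as `u
→ x → v i → u` lets `l + 2` guards suffice, and even `l + 1` if no part has more than two vertices.

The core is `IsCone.card_add_two_le`: `l + 1` guards fail if one part has at least three vertices
and another at least two. With `l + 1` guards there is one spare guard, on `u` or as a second guard
of one part. Call `x` a source if `x → u` and a target if `u → x`. While a source is the only guard
of a part of at least two vertices, `u` is guarded, and no other part gets a second guard. Both of
these parts contain sources, and a part of three vertices has two sources or two targets; either
case is contradictory (`false_of_source_of_not_adj`, `false_of_two_targets`).

If only one part has more than one vertex, all others are leaves at `u`, which cost one permanent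
guard each. The remaining block has two universal vertices and value 2 or 3. Two guards fail if some
vertex has two non-neighbors, which by the absence of induced 4-cycles happens as soon as three
vertices are not universal. Otherwise the block is complete up to at most one edge, and two guards
rotate around a cyclic order, three vertices being treated separately.

For the running time, `guardCount` expresses the value by degrees alone: the universal vertex and
the `v i` of each component are those with at most one neighbor above them in the order by degree,
and `NeedsGuard` decides on the additional guard. All of this takes a bounded number of passes over
each adjacency list. -/

namespace EternalDomination

/-! ### Closed families, orientations and the minimum over orientations. -/

section Basic

variable {V : Type*} {G : SimpleGraph V} {H D : Digraph V} {S T : Set V}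

/-- The guards standing on `S` can move to `T` in one turn. -/
def Step (H : Digraph V) (S T : Set V) : Prop :=
  ∃ f : V → V, IsMultimove H S f ∧ f '' S = T

theorem Step.ncard_eq (h : Step H S T) : T.ncard = S.ncard := by
  obtain ⟨f, hf, rfl⟩ := h
  exact hf.1.ncard_image

theorem isMultimove_id : IsMultimove H S id :=
  ⟨Function.injective_id.injOn, fun _ _ => Or.inl rfl⟩

theorem subset_MEDS {F : Set (Set V)} (hF : ClosedUnderDefense H F) : F ⊆ MEDS H :=
  fun _ hS => ⟨F, hF, hS⟩

/-- Additional arcs only add multimoves, so a strategy has to specify only the arcs it uses. -/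
theorem MEDS_mono (h : ∀ x y, D.Adj x y → H.Adj x y) : MEDS D ⊆ MEDS H := by
  refine subset_MEDS fun S hS r hr => ?_
  obtain ⟨f, hf, hrf, hT⟩ := closedUnderDefense_MEDS D S hS r hr
  exact ⟨f, ⟨hf.1, fun x hx => (hf.2 x hx).imp id (h _ _)⟩, hrf, hT⟩

/-- An attack on a guarded vertex is answered by standing still, which saves case distinctions
later. -/
theorem exists_step_of_mem_MEDS (hS : S ∈ MEDS H) (r : V) :
    ∃ T ∈ MEDS H, r ∈ T ∧ Step H S T := by
  by_cases hr : r ∈ S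
  · exact ⟨S, hS, hr, id, isMultimove_id, by simp⟩
  · obtain ⟨f, hf, hrf, hT⟩ := closedUnderDefense_MEDS H S hS r hr
    exact ⟨_, hT, hrf, f, hf, rfl⟩

/-- Ensures that the infimum in `mEternalNumber` is not the default value of `sInf ∅`. -/
theorem univ_mem_MEDS (H : Digraph V) : Set.univ ∈ MEDS H :=
  subset_MEDS (F := {Set.univ}) (by rintro S rfl r hr; exact absurd trivial hr) rfl

theorem mEternalNumber_le (hS : S ∈ MEDS H) : mEternalNumber H ≤ S.ncard :=
  Nat.sInf_le ⟨S, hS, rfl⟩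

theorem exists_mem_MEDS_ncard_eq (H : Digraph V) :
    ∃ S ∈ MEDS H, S.ncard = mEternalNumber H :=
  Nat.sInf_mem (s := {k | ∃ S ∈ MEDS H, S.ncard = k}) ⟨_, _, univ_mem_MEDS H, rfl⟩

/-- Every digraph that orients some of the edges of `G` extends to an orientation of `G`. -/
theorem exists_isOrientation_extending (hG : ∀ x y, D.Adj x y → G.Adj x y)
    (hD : ∀ x y, D.Adj x y → ¬ D.Adj y x) :
    ∃ H, IsOrientation G H ∧ ∀ x y, D.Adj x y → H.Adj x y := by
  -- Edges left open by `D` are directed upwards in a well-order of the vertices.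
  refine ⟨⟨fun x y => D.Adj x y ∨ (G.Adj x y ∧ ¬ D.Adj y x ∧ WellOrderingRel x y)⟩,
    ⟨fun u v => ?_, fun u v => ?_⟩, fun x y h => Or.inl h⟩
  · constructor
    · intro h
      by_cases h1 : D.Adj u v
      · exact Or.inl (Or.inl h1)
      by_cases h2 : D.Adj v u
      · exact Or.inr (Or.inl h2)
      rcases trichotomous_of WellOrderingRel u v with h3 | h3 | h3
      · exact Or.inl (Or.inr ⟨h, h2, h3⟩)
      · exact absurd h3 h.ne
      · exact Or.inr (Or.inr ⟨h.symm, h1, h3⟩)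
    · rintro ((h | h) | (h | h))
      exacts [hG _ _ h, h.1, (hG _ _ h).symm, h.1.symm]
  · rintro ⟨h1 | h1, h2 | h2⟩
    · exact hD _ _ h1 h2
    · exact h2.2.1 h1
    · exact h1.2.1 h2
    · exact asymm_of WellOrderingRel h1.2.2 h2.2.2

theorem orientedMEternalNumber_le_mEternalNumber (hH : IsOrientation G H) :
    orientedMEternalNumber G ≤ mEternalNumber H :=
  Nat.sInf_le ⟨H, hH, rfl⟩

theorem orientedMEternalNumber_le (hG : ∀ x y, D.Adj x y → G.Adj x y)
    (hD : ∀ x y, D.Adj x y → ¬ D.Adj y x) (hS : S ∈ MEDS D) :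
    orientedMEternalNumber G ≤ S.ncard := by
  obtain ⟨H, hH, hDH⟩ := exists_isOrientation_extending hG hD
  exact (orientedMEternalNumber_le_mEternalNumber hH).trans (mEternalNumber_le (MEDS_mono hDH hS))

theorem exists_isOrientation_mem_MEDS (G : SimpleGraph V) :
    ∃ H, IsOrientation G H ∧ ∃ S ∈ MEDS H, S.ncard = orientedMEternalNumber G := by
  -- Extending the empty digraph shows that orientations exist, so that the infimum is attained.
  obtain ⟨H₀, hH₀, -⟩ := exists_isOrientation_extending (G := G) (D := ⟨fun _ _ => False⟩)
    (by simp) (by simp)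
  obtain ⟨H, hH, h⟩ := Nat.sInf_mem (s := {k | ∃ H : Digraph V, IsOrientation G H ∧
    mEternalNumber H = k}) ⟨_, H₀, hH₀, rfl⟩
  obtain ⟨S, hS, h'⟩ := exists_mem_MEDS_ncard_eq H
  exact ⟨H, hH, S, hS, h'.trans h⟩

theorem le_orientedMEternalNumber {k : ℕ}
    (h : ∀ H, IsOrientation G H → ∀ S ∈ MEDS H, k ≤ S.ncard) : k ≤ orientedMEternalNumber G := by
  obtain ⟨H, hH, S, hS, hk⟩ := exists_isOrientation_mem_MEDS G
  exact (h H hH S hS).trans hk.le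

theorem orientedMEternalNumber_le_of_isOrientation (hH : IsOrientation G H) (hS : S ∈ MEDS H) :
    orientedMEternalNumber G ≤ S.ncard :=
  (orientedMEternalNumber_le_mEternalNumber hH).trans (mEternalNumber_le hS)

/-! ### Induced subgraphs -/

/-- The subdigraph induced by `B`. -/
def restrict (H : Digraph V) (B : Set V) : Digraph B := ⟨fun x y => H.Adj x y⟩

theorem IsOrientation.restrict (hH : IsOrientation G H) (B : Set V) :
    IsOrientation (G.induce B) (restrict H B) :=
  ⟨fun u v => hH.1 u v, fun u v => hH.2 u v⟩

/-- If a family of guard sets can be defended against attacks on `B` by multimoves that never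
cross the boundary of `B`, then its traces on `B` are m-eternal dominating sets. -/
theorem preimage_mem_MEDS_restrict {B : Set V} {F : Set (Set V)}
    (hF : ∀ S ∈ F, ∀ r ∈ B, r ∉ S → ∃ f : V → V, IsMultimove H S f ∧ r ∈ f '' S ∧ f '' S ∈ F ∧
      ∀ x ∈ S, (f x ∈ B ↔ x ∈ B)) (hS : S ∈ F) :
    ((↑) ⁻¹' S : Set B) ∈ MEDS (restrict H B) := by
  classical
  refine subset_MEDS (F := (fun S => ((↑) ⁻¹' S : Set B)) '' F) ?_ ⟨S, hS, rfl⟩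
  rintro _ ⟨S, hS, rfl⟩ r hr
  obtain ⟨f, hf, hrf, hT, hB⟩ := hF S hS r r.2 hr
  -- The default `x` is never used on guards, since guards in `B` stay in `B`.
  let g : B → B := fun x => if h : f x ∈ B then ⟨f x, h⟩ else x
  have hg : ∀ x : B, (x : V) ∈ S → (g x : V) = f x := fun x hx => by
    simp [g, (hB x hx).2 x.2]
  have himg : g '' ((↑) ⁻¹' S) = (↑) ⁻¹' (f '' S) := by
    ext y
    constructor
    · rintro ⟨x, hx, rfl⟩
      exact ⟨x, hx, (hg x hx).symm⟩
    · rintro ⟨x, hx, hxy⟩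
      have hxB : x ∈ B := (hB x hx).1 (hxy ▸ y.2)
      exact ⟨⟨x, hxB⟩, hx, Subtype.ext ((hg ⟨x, hxB⟩ hx).trans hxy)⟩
  refine ⟨g, ⟨fun x hx y hy hxy => ?_, fun x hx => ?_⟩, ?_, ?_⟩
  · exact Subtype.ext (hf.1 hx hy (by rw [← hg x hx, ← hg y hy, hxy]))
  · refine (hf.2 x hx).imp (fun h => Subtype.ext ((hg x hx).trans h)) fun h => ?_
    change H.Adj x (g x)
    rwa [hg x hx]
  · rw [himg]; exact hrf
  · rw [himg]; exact ⟨_, hT, rfl⟩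

/-- Guard sets of pairwise disjoint induced subdigraphs combine, with permanent guards on all
other vertices. -/
theorem mem_MEDS_of_preimage {ι : Type*} {B : ι → Set V}
    (hB : Pairwise fun i j => Disjoint (B i) (B j)) (hS : ∀ x, (∀ i, x ∉ B i) → x ∈ S)
    (h : ∀ i, ((↑) ⁻¹' S : Set (B i)) ∈ MEDS (restrict H (B i))) : S ∈ MEDS H := by
  classical
  refine subset_MEDS (F := {S | (∀ x, (∀ i, x ∉ B i) → x ∈ S) ∧
    ∀ i, ((↑) ⁻¹' S : Set (B i)) ∈ MEDS (restrict H (B i))}) ?_ ⟨hS, h⟩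
  rintro S ⟨hS, h⟩ r hr
  obtain ⟨i, hi⟩ : ∃ i, r ∈ B i := by
    by_contra! hc
    exact hr (hS r hc)
  obtain ⟨g, hg, hrg, hT⟩ := closedUnderDefense_MEDS _ _ (h i) ⟨r, hi⟩ hr
  let f : V → V := fun x => if hx : x ∈ B i then g ⟨x, hx⟩ else x
  have hf1 : ∀ x : B i, f x = g x := fun x => by simp [f]
  have hf2 : ∀ x, x ∉ B i → f x = x := fun x hx => by simp [f, hx]
  have hf3 : ∀ x, f x ∈ B i ↔ x ∈ B i := fun x => by
    by_cases hx : x ∈ B i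
    · simp [hx, hf1 ⟨x, hx⟩]
    · simp [hx, hf2 x hx]
  have himg : ((↑) ⁻¹' (f '' S) : Set (B i)) = g '' ((↑) ⁻¹' S) := by
    ext y
    constructor
    · rintro ⟨x, hx, hxy⟩
      have hxB : x ∈ B i := (hf3 x).1 (hxy ▸ y.2)
      exact ⟨⟨x, hxB⟩, hx, Subtype.ext ((hf1 ⟨x, hxB⟩).symm.trans hxy)⟩
    · rintro ⟨x, hx, rfl⟩
      exact ⟨x, hx, hf1 x⟩
  have hout : ∀ x, x ∉ B i → (x ∈ f '' S ↔ x ∈ S) := fun x hx => by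
    constructor
    · rintro ⟨y, hy, rfl⟩
      have : y ∉ B i := fun h => hx ((hf3 y).2 h)
      rwa [hf2 y this]
    · exact fun h => ⟨x, h, hf2 x hx⟩
  refine ⟨f, ⟨fun x hx y hy hxy => ?_, fun x hx => ?_⟩, ?_, fun x hx => ?_, fun j => ?_⟩
  · by_cases hxB : x ∈ B i
    · have hyB : y ∈ B i := (hf3 y).1 (hxy ▸ (hf3 x).2 hxB)
      rw [hf1 ⟨x, hxB⟩, hf1 ⟨y, hyB⟩] at hxy
      exact congrArg Subtype.val
        (hg.1 (x₁ := ⟨x, hxB⟩) (x₂ := ⟨y, hyB⟩) hx hy (Subtype.ext hxy))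
    · have hyB : y ∉ B i := fun h => hxB ((hf3 x).1 (hxy ▸ (hf3 y).2 h))
      rwa [hf2 x hxB, hf2 y hyB] at hxy
  · by_cases hxB : x ∈ B i
    · rw [hf1 ⟨x, hxB⟩]
      exact (hg.2 ⟨x, hxB⟩ hx).imp (congrArg Subtype.val) id
    · exact Or.inl (hf2 x hxB)
  · obtain ⟨x, hx, hxr⟩ := hrg
    exact ⟨x, hx, (hf1 x).trans (congrArg Subtype.val hxr)⟩
  · exact (hout x (hx i)).2 (hS x hx)
  · by_cases hij : j = i
    · subst hij
      rw [himg]; exact hT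
    · have : ((↑) ⁻¹' (f '' S) : Set (B j)) = (↑) ⁻¹' S := by
        ext y
        exact hout y (Set.disjoint_left.1 (hB hij) y.2)
      rw [this]; exact h j

theorem ncard_preimage_val (B S : Set V) : ((↑) ⁻¹' S : Set B).ncard = (S ∩ B).ncard := by
  rw [← Set.ncard_image_of_injective _ Subtype.val_injective, Subtype.image_preimage_coe,
    Set.inter_comm]

theorem ncard_eq_sum_fibers [Finite V] {ι : Type*} [Fintype ι] (c : V → ι) (S : Set V) :
    S.ncard = ∑ i, (S ∩ {x | c x = i}).ncard := by
  classical
  have := Fintype.ofFinite V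
  have := Fintype.ofFinite S
  rw [Set.ncard_eq_toFinset_card' S, Finset.card_eq_sum_card_fiberwise (f := c)
    (t := Finset.univ) (by simp)]
  refine Finset.sum_congr rfl fun i _ => ?_
  rw [← Set.ncard_coe_finset]
  congr 1
  ext x
  simp

/-- Permanent guards are placed outside `B`, and only the edges inside `B` need a prescribed
direction. -/
theorem orientedMEternalNumber_le_induce_add [Finite V] (B : Set V) :
    orientedMEternalNumber G ≤ orientedMEternalNumber (G.induce B) + Bᶜ.ncard := by
  obtain ⟨H, hH, A, hA, hk⟩ := exists_isOrientation_mem_MEDS (G.induce B)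
  let D : Digraph V := ⟨fun x y => ∃ (hx : x ∈ B) (hy : y ∈ B), H.Adj ⟨x, hx⟩ ⟨y, hy⟩⟩
  have hD : restrict D B = H := by
    ext x y
    simp [restrict, D]
  have hpre : ((↑) ⁻¹' ((↑) '' A ∪ Bᶜ) : Set B) = A := by
    ext x
    simp
  have hS : (↑) '' A ∪ Bᶜ ∈ MEDS D := by
    refine mem_MEDS_of_preimage (ι := Unit) (B := fun _ => B) (fun i j h => absurd rfl h)
      (fun x hx => Or.inr (hx ())) fun _ => ?_
    rw [hpre, hD]; exact hA
  refine (orientedMEternalNumber_le (G := G) ?_ ?_ hS).trans ?_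
  · rintro x y ⟨hx, hy, h⟩
    exact (hH.1 ⟨x, hx⟩ ⟨y, hy⟩).2 (Or.inl h)
  · rintro x y ⟨hx, hy, h⟩ ⟨hy', hx', h'⟩
    exact hH.2 ⟨x, hx⟩ ⟨y, hy⟩ ⟨h, h'⟩
  · refine (Set.ncard_union_le _ _).trans ?_
    rw [Set.ncard_image_of_injective _ Subtype.val_injective, hk]

/-- The oriented m-eternal domination number is additive over a partition of the vertices
without edges between different parts. -/
theorem orientedMEternalNumber_eq_sum [Finite V] {ι : Type*} [Fintype ι] (c : V → ι)
    (hc : ∀ x y, G.Adj x y → c x = c y) :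
    orientedMEternalNumber G = ∑ i, orientedMEternalNumber (G.induce {x | c x = i}) := by
  apply le_antisymm
  · choose H hH A hA hk using fun i => exists_isOrientation_mem_MEDS (G.induce {x | c x = i})
    let D : Digraph V := ⟨fun x y => ∃ h : c y = c x, (H (c x)).Adj ⟨x, rfl⟩ ⟨y, h⟩⟩
    have hD : ∀ i, restrict D {x | c x = i} = H i := fun i => by
      ext ⟨x, hx⟩ ⟨y, hy⟩
      obtain rfl : c x = i := hx
      have hy' : c y = c x := hy
      simp [restrict, D, hy']
    have hpre : ∀ i, ((↑) ⁻¹' {x | ⟨x, rfl⟩ ∈ A (c x)} : Set {x | c x = i}) = A i := fun i => by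
      ext ⟨x, hx⟩
      obtain rfl : c x = i := hx
      simp
    have hS : {x | ⟨x, rfl⟩ ∈ A (c x)} ∈ MEDS D := by
      refine mem_MEDS_of_preimage (B := fun i => {x | c x = i}) (fun i j h => ?_)
        (fun x hx => absurd rfl (hx (c x))) fun i => ?_
      · exact Set.disjoint_left.2 fun x hx hx' => h (hx.symm.trans hx')
      · rw [hpre, hD]; exact hA i
    refine (orientedMEternalNumber_le (G := G) ?_ ?_ hS).trans ?_
    · rintro x y ⟨h, h'⟩
      exact ((hH (c x)).1 ⟨x, rfl⟩ ⟨y, h⟩).2 (Or.inl h')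
    · rintro x y ⟨h, h1⟩ ⟨h', h2⟩
      refine (hH (c x)).2 ⟨x, rfl⟩ ⟨y, h⟩ ⟨h1, ?_⟩
      -- The color is generalized to a variable so that `H (c y)` and `H (c x)` can be identified.
      have : ∀ i (e : i = c y) (e' : i = c x), (H i).Adj ⟨y, e.symm⟩ ⟨x, e'.symm⟩ := by
        rintro _ rfl e
        exact h2
      exact this (c x) h.symm rfl
    · rw [ncard_eq_sum_fibers c]
      refine Finset.sum_le_sum fun i _ => ?_
      rw [← hk i, ← ncard_preimage_val, hpre]
  · refine le_orientedMEternalNumber fun H hH S hS => ?_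
    rw [ncard_eq_sum_fibers c]
    refine Finset.sum_le_sum fun i _ => ?_
    rw [← ncard_preimage_val]
    refine orientedMEternalNumber_le_of_isOrientation (hH.restrict _)
      (preimage_mem_MEDS_restrict (F := MEDS H) (fun T hT r _ hr => ?_) hS)
    obtain ⟨f, hf, hrf, hT'⟩ := closedUnderDefense_MEDS H T hT r hr
    refine ⟨f, hf, hrf, hT', fun x hx => ?_⟩
    rcases hf.2 x hx with h | h
    · rw [h]
    · have := hc _ _ ((hH.1 _ _).2 (Or.inl h))
      simp [this]

end Basic

/-! ### Orientations with a universal vertex: the lower bound of one guard per part plus one. -/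

section Cone

variable {V ι : Type*}

/-- The vertices other than `u` of color `i`. -/
def part (u : V) (c : V → ι) (i : ι) : Set V := {x | x ≠ u ∧ c x = i}

/-- The digraph `H` has no antiparallel arcs, the vertex `u` is joined to all other vertices, and
all other arcs join vertices of the same color. Every color occurs at a vertex other than `u`. -/
structure IsCone (H : Digraph V) (u : V) (c : V → ι) : Prop where
  asymm : ∀ x y, H.Adj x y → ¬ H.Adj y x
  star : ∀ x, x ≠ u → H.Adj u x ∨ H.Adj x u
  color : ∀ x y, H.Adj x y → x ≠ u → y ≠ u → c x = c y
  surj : ∀ i, (part u c i).Nonempty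

variable {H : Digraph V} {u : V} {c : V → ι} {S T : Set V} {f : V → V} {i j : ι} {x y r d e o : V}

namespace IsCone

theorem irrefl (hH : IsCone H u c) (x : V) : ¬ H.Adj x x := fun h => hH.asymm x x h h

theorem mem_part_of_adj (hH : IsCone H u c) (h : H.Adj x y) (hx : x ≠ u) (hy : y ∈ part u c i) :
    x ∈ part u c i :=
  ⟨hx, (hH.color x y h hx hy.1).trans hy.2⟩

theorem apply_mem_part (hH : IsCone H u c) (hf : IsMultimove H S f) (hxS : x ∈ S)
    (hx : x ∈ part u c i) : f x = u ∨ f x ∈ part u c i := by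
  rcases hf.2 x hxS with h | h
  · exact Or.inr (by rwa [h])
  · by_cases hu : f x = u
    · exact Or.inl hu
    · exact Or.inr ⟨hu, (hH.color _ _ h hx.1 hu).symm.trans hx.2⟩

theorem adj_of_apply_eq (hf : IsMultimove H S f) (hxS : x ∈ S) (h : f x = y) (hxy : x ≠ y) :
    H.Adj x y := by
  rcases hf.2 x hxS with h' | h'
  · exact absurd (h'.symm.trans h) hxy
  · rwa [h] at h'

/-- A guard that enters a part comes from `u`. -/
theorem eq_or_mem_part (hH : IsCone H u c) (hf : IsMultimove H S f) (hxS : x ∈ S)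
    (h : f x ∈ part u c i) : x = u ∨ x ∈ part u c i := by
  by_cases hu : x = u
  · exact Or.inl hu
  rcases hf.2 x hxS with h' | h'
  · exact Or.inr (by rwa [h'] at h)
  · exact Or.inr (hH.mem_part_of_adj h' hu h)

/-- If a part is empty of guards, an attack in it can be answered only from `u`. -/
theorem adj_of_disjoint (hH : IsCone H u c) (hT : T ∈ MEDS H) (h : ∀ y ∈ T, y ∉ part u c i)
    (hx : x ∈ part u c i) : H.Adj u x := by
  obtain ⟨T', -, hxT', f, hf, rfl⟩ := exists_step_of_mem_MEDS hT x
  obtain ⟨z, hz, rfl⟩ := hxT'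
  rcases hH.eq_or_mem_part hf hz hx with rfl | h'
  · exact adj_of_apply_eq hf hz rfl hx.1.symm
  · exact absurd h' (h z hz)

/-- Emptying a part would need an arc from it to `u`, while defending the emptied part needs all
arcs from `u` into it. -/
theorem nonempty_inter_image (hH : IsCone H u c) (hf : IsMultimove H S f) (hT : f '' S ∈ MEDS H)
    (h : (S ∩ part u c i).Nonempty) : (f '' S ∩ part u c i).Nonempty := by
  by_contra hc
  obtain ⟨x, hxS, hx⟩ := h
  have hu := hH.adj_of_disjoint hT (fun y hy hy' => hc ⟨y, hy, hy'⟩) hx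
  rcases hH.apply_mem_part hf hxS hx with h | h
  · exact hH.asymm _ _ hu (adj_of_apply_eq hf hxS h hx.1)
  · exact hc ⟨_, ⟨x, hxS, rfl⟩, h⟩

/-- Occupied parts stay occupied, so a reachable set with a maximal collection of occupied parts
occupies all of them; an attack on `u` then adds `u`. -/
theorem exists_full [Finite V] (hH : IsCone H u c) (hS : S ∈ MEDS H) :
    ∃ T ∈ MEDS H, T.ncard = S.ncard ∧ u ∈ T ∧ ∀ i, (T ∩ part u c i).Nonempty := by
  obtain ⟨T, ⟨hT, hTS⟩, hmax⟩ := (Set.toFinite {T | T ∈ MEDS H ∧ T.ncard = S.ncard}).exists_maximalFor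
    (fun T => {i | (T ∩ part u c i).Nonempty}) _ ⟨S, hS, rfl⟩
  have hfull : ∀ i, (T ∩ part u c i).Nonempty := fun i => by
    obtain ⟨r, hr⟩ := hH.surj i
    obtain ⟨T', hT', hrT', f, hf, rfl⟩ := exists_step_of_mem_MEDS hT r
    exact hmax (j := f '' T) ⟨hT', hf.1.ncard_image.trans hTS⟩
      (fun j hj => hH.nonempty_inter_image hf hT' hj) ⟨r, hrT', hr⟩
  obtain ⟨T', hT', hrT', f, hf, rfl⟩ := exists_step_of_mem_MEDS hT u
  exact ⟨_, hT', hf.1.ncard_image.trans hTS, hrT',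
    fun i => hH.nonempty_inter_image hf hT' (hfull i)⟩

end IsCone

theorem ncard_eq_sum_part [Finite V] [Fintype ι] (u : V) (c : V → ι) (T : Set V) :
    T.ncard = (T ∩ {u}).ncard + ∑ i, (T ∩ part u c i).ncard := by
  have h : ∀ i, T ∩ part u c i = (T \ {u}) ∩ {x | c x = i} := fun i => by
    ext x; simp [part, and_assoc]
  simp_rw [h]
  rw [← ncard_eq_sum_fibers, Set.ncard_inter_add_ncard_sdiff_eq_ncard]

theorem IsCone.card_add_one_le [Finite V] [Fintype ι] (hH : IsCone H u c) (hS : S ∈ MEDS H) :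
    Fintype.card ι + 1 ≤ S.ncard := by
  obtain ⟨T, hT, hTS, hu, h⟩ := hH.exists_full hS
  rw [← hTS, ncard_eq_sum_part u c, add_comm, Set.inter_eq_right.2 (Set.singleton_subset_iff.2 hu),
    Set.ncard_singleton]
  gcongr
  rw [Fintype.card_eq_sum_ones]
  exact Finset.sum_le_sum fun i _ => (Set.ncard_pos (Set.toFinite _)).2 (h i)

/-- An m-eternal dominating set with one guard more than there are parts, no part being empty. -/
structure IsTight [Fintype ι] (H : Digraph V) (u : V) (c : V → ι) (T : Set V) : Prop where
  mem : T ∈ MEDS H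
  card : T.ncard = Fintype.card ι + 1
  full : ∀ i, (T ∩ part u c i).Nonempty

/-- `x` is the only guard of the part `i`. -/
def IsSingle (u : V) (c : V → ι) (T : Set V) (i : ι) (x : V) : Prop := T ∩ part u c i = {x}

theorem IsSingle.mem (h : IsSingle u c T i x) : x ∈ T := (h.symm ▸ rfl : x ∈ T ∩ part u c i).1

theorem IsSingle.mem_part (h : IsSingle u c T i x) : x ∈ part u c i :=
  (h.symm ▸ rfl : x ∈ T ∩ part u c i).2

theorem IsSingle.eq (h : IsSingle u c T i x) (hy : y ∈ T) (hy' : y ∈ part u c i) : y = x := by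
  have : y ∈ T ∩ part u c i := ⟨hy, hy'⟩
  rwa [h] at this

theorem isSingle_iff : IsSingle u c T i x ↔
    x ∈ T ∧ x ∈ part u c i ∧ ∀ y ∈ T, y ∈ part u c i → y = x :=
  ⟨fun h => ⟨h.mem, h.mem_part, fun _ => h.eq⟩, fun h => Set.eq_singleton_iff_unique_mem.2
    ⟨⟨h.1, h.2.1⟩, fun y hy => h.2.2 y hy.1 hy.2⟩⟩

namespace IsCone

/-- Guards enter a part only from `u`. Hence the position of an only guard changes along an arc of
the part or by an exchange: the guard of `u` enters while the one on `x` moves to `u`. -/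
theorem single_step (hH : IsCone H u c) (hf : IsMultimove H S f) (hx : IsSingle u c S i x)
    (hy : IsSingle u c (f '' S) i y) :
    y = x ∨ H.Adj x y ∨ (u ∈ S ∧ f u = y ∧ f x = u ∧ H.Adj u y ∧ H.Adj x u) := by
  obtain ⟨z, hz, hzy⟩ := hy.mem
  rcases hH.eq_or_mem_part hf hz (hzy ▸ hy.mem_part) with rfl | hz'
  · have hfx : f x = z := by
      rcases hH.apply_mem_part hf hx.mem hx.mem_part with h | h
      · exact h
      · exact absurd (hf.1 hx.mem hz ((hy.eq ⟨x, hx.mem, rfl⟩ h).trans hzy.symm)) hx.mem_part.1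
    exact Or.inr (Or.inr ⟨hz, hzy, hfx, adj_of_apply_eq hf hz hzy hy.mem_part.1.symm,
      adj_of_apply_eq hf hx.mem hfx hx.mem_part.1⟩)
  · obtain rfl := hx.eq hz hz'
    rcases hf.2 z hz with h | h
    · exact Or.inl (hzy.symm.trans h)
    · exact Or.inr (Or.inl (hzy ▸ h))

/-- The only guard of a part dominates the vertices that cannot be reached from `u`. -/
theorem adj_of_single (hH : IsCone H u c) (hT : T ∈ MEDS H) (hx : IsSingle u c T i x)
    (hr : r ∈ part u c i) (hrx : r ≠ x) (h : u ∉ T ∨ H.Adj r u) : H.Adj x r := by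
  obtain ⟨T', -, hrT', f, hf, rfl⟩ := exists_step_of_mem_MEDS hT r
  obtain ⟨z, hz, rfl⟩ := hrT'
  rcases hH.eq_or_mem_part hf hz hr with rfl | hz'
  · have := adj_of_apply_eq hf hz rfl hr.1.symm
    exact h.elim (absurd hz) (fun h => absurd h (hH.asymm _ _ this))
  · obtain rfl := hx.eq hz hz'
    exact adj_of_apply_eq hf hz rfl hrx.symm

end IsCone

/-! ### Sets with exactly one spare guard. -/

section Tight

variable [Fintype ι]

/-- Beyond one guard per part there is just one more guard; a second guard in the part `i` uses it
up. -/
theorem IsTight.single_or [Finite V] (hT : IsTight H u c T) (i : ι) :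
    (∃ x, IsSingle u c T i x) ∨ u ∉ T ∧ ∀ j, j ≠ i → ∃ x, IsSingle u c T j x := by
  classical
  have h1 : ∀ j, 1 ≤ (T ∩ part u c j).ncard := fun j => (Set.ncard_pos (Set.toFinite _)).2 (hT.full j)
  have h2 : ∑ j, (T ∩ part u c j).ncard = ∑ j, ((T ∩ part u c j).ncard - 1) + Fintype.card ι := by
    rw [Fintype.card_eq_sum_ones, ← Finset.sum_add_distrib]
    exact Finset.sum_congr rfl fun j _ => (Nat.sub_add_cancel (h1 j)).symm
  have h3 := ncard_eq_sum_part u c T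
  rw [hT.card, h2] at h3
  by_cases hi : (T ∩ part u c i).ncard = 1
  · exact Or.inl (Set.ncard_eq_one.1 hi)
  have h4 := Finset.single_le_sum (f := fun j => (T ∩ part u c j).ncard - 1)
    (fun _ _ => Nat.zero_le _) (Finset.mem_univ i)
  have hi1 := h1 i
  refine Or.inr ⟨fun hu => ?_, fun j hj => Set.ncard_eq_one.1 ?_⟩
  · rw [Set.inter_eq_right.2 (Set.singleton_subset_iff.2 hu), Set.ncard_singleton] at h3
    omega
  · have h5 := Finset.sum_le_sum_of_subset (f := fun j => (T ∩ part u c j).ncard - 1)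
      (Finset.subset_univ {i, j})
    rw [Finset.sum_pair hj.symm] at h5
    have hj1 := h1 j
    omega

theorem IsTight.exists_single [Finite V] (hT : IsTight H u c T) (hu : u ∈ T) (i : ι) :
    ∃ x, IsSingle u c T i x :=
  (hT.single_or i).resolve_right fun h => h.1 hu

theorem IsTight.exists_step (hH : IsCone H u c) (hS : IsTight H u c S) (r : V) :
    ∃ f, IsMultimove H S f ∧ IsTight H u c (f '' S) ∧ r ∈ f '' S := by
  obtain ⟨T, hT, hr, f, hf, rfl⟩ := exists_step_of_mem_MEDS hS.mem r
  exact ⟨f, hf, ⟨hT, hf.1.ncard_image.trans hS.card,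
    fun i => hH.nonempty_inter_image hf hT (hS.full i)⟩, hr⟩

namespace IsCone

/-- If `u` is not guarded, then a part with a single guard keeps a single guard. -/
theorem single_of_not_mem (hH : IsCone H u c) (hf : IsMultimove H S f)
    (hT : IsTight H u c (f '' S)) (hu : u ∉ S) (hx : IsSingle u c S i x) :
    IsSingle u c (f '' S) i (f x) := by
  have key : ∀ y ∈ f '' S, y ∈ part u c i → y = f x := by
    rintro _ ⟨z, hz, rfl⟩ hy
    rcases hH.eq_or_mem_part hf hz hy with rfl | hz'
    · exact absurd hz hu
    · rw [hx.eq hz hz']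
  obtain ⟨y, hy, hy'⟩ := hT.full i
  obtain rfl := key y hy hy'
  exact isSingle_iff.2 ⟨hy, hy', key⟩

theorem single_of_not_mem_of_mem (hH : IsCone H u c) (hf : IsMultimove H S f)
    (hT : IsTight H u c (f '' S)) (hu : u ∉ S) (hx : IsSingle u c S i x) (hr : r ∈ f '' S)
    (hr' : r ∈ part u c i) : IsSingle u c (f '' S) i r := by
  have h := hH.single_of_not_mem hf hT hu hx
  rwa [h.eq hr hr']

/-- With two guards in the part `i`, every other part has a single guard that cannot be replaced, so
only the part `i` can send a guard to `u`. -/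
theorem step_from_double [Finite V] (hH : IsCone H u c) (hS : IsTight H u c S)
    (h : ¬ ∃ x, IsSingle u c S i x) (hf : IsMultimove H S f) (hT : IsTight H u c (f '' S))
    (hu : u ∈ f '' S) : ∃ z ∈ S, z ∈ part u c i ∧ f z = u := by
  obtain ⟨huS, hsg⟩ := (hS.single_or i).resolve_left h
  obtain ⟨z, hz, hzu⟩ := hu
  have hzu' : z ≠ u := fun h => huS (h ▸ hz)
  by_cases hi : c z = i
  · exact ⟨z, hz, ⟨hzu', hi⟩, hzu⟩
  · obtain ⟨x, hx⟩ := hsg _ hi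
    obtain rfl := hx.eq hz ⟨hzu', rfl⟩
    have := (hH.single_of_not_mem hf hT huS hx).mem_part.1
    exact absurd hzu this

/-- If `u` is not guarded, then the only guard of a part of at least two vertices can be reached
from `u`. -/
theorem adj_of_single_of_not_mem [Finite V] (hH : IsCone H u c) (hT : IsTight H u c T) (hu : u ∉ T)
    (hd : IsSingle u c T i d) (hi : (part u c i).Nontrivial) : H.Adj u d := by
  refine (hH.star d hd.mem_part.1).resolve_right fun hdu => ?_
  -- As the only guard with `u` unguarded, `d` must dominate its whole part; so `d` has no
  -- in-neighbor at all and its guard can never be replaced.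
  have hsrc : ∀ y, ¬ H.Adj y d := fun y hy => by
    by_cases hyu : y = u
    · exact hH.asymm _ _ hdu (hyu ▸ hy)
    · have hyd : y ≠ d := fun h => hH.irrefl d (h ▸ hy)
      exact hH.asymm _ _ hy (hH.adj_of_single hT.mem hd
        (hH.mem_part_of_adj hy hyu hd.mem_part) hyd (Or.inl hu))
  have hmem : ∀ S ∈ MEDS H, d ∈ S := fun S hS => by
    obtain ⟨S', -, hd', f, hf, rfl⟩ := exists_step_of_mem_MEDS hS d
    obtain ⟨z, hz, hzd⟩ := hd'
    by_cases h : z = d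
    · exact h ▸ hz
    · exact absurd (adj_of_apply_eq hf hz hzd h) (hsrc z)
  have hfix : ∀ S (f : V → V), IsMultimove H S f → f '' S ∈ MEDS H → f d = d := fun S f hf hS => by
    obtain ⟨z, hz, hzd⟩ := hmem _ hS
    by_cases h : z = d
    · exact h ▸ hzd
    · exact absurd (adj_of_apply_eq hf hz hzd h) (hsrc z)
  -- Attack `u`, then another vertex `r` of the part, then `u` again. The guard on `r` came from
  -- `u`, so it cannot go back, and the guard on `d` never moves.
  obtain ⟨r, hr, hrd⟩ := hi.exists_ne d
  obtain ⟨f₁, hf₁, hT₁, hu₁⟩ := hT.exists_step hH u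
  have hd₁ := hH.single_of_not_mem_of_mem hf₁ hT₁ hu hd (hmem _ hT₁.mem) hd.mem_part
  obtain ⟨f₂, hf₂, hT₂, hr₂⟩ := hT₁.exists_step hH r
  have hfr : f₂ u = r := by
    obtain ⟨z, hz, hzr⟩ := hr₂
    rcases hH.eq_or_mem_part hf₂ hz (hzr ▸ hr) with rfl | hz'
    · exact hzr
    · obtain rfl := hd₁.eq hz hz'
      exact absurd (hzr.symm.trans (hfix _ _ hf₂ hT₂.mem)) hrd
  have hur : H.Adj u r := adj_of_apply_eq hf₂ hu₁ hfr hr.1.symm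
  have hns : ¬ ∃ x, IsSingle u c (f₂ '' (f₁ '' T)) i x := by
    rintro ⟨x, hx⟩
    exact hrd ((hx.eq hr₂ hr).trans (hx.eq (hmem _ hT₂.mem) hd.mem_part).symm)
  obtain ⟨f₃, hf₃, hT₃, hu₃⟩ := hT₂.exists_step hH u
  obtain ⟨z, ⟨w, hw, rfl⟩, hz', hzu⟩ := hH.step_from_double hT₂ hns hf₃ hT₃ hu₃
  rcases hH.eq_or_mem_part hf₂ hw hz' with rfl | hw'
  · rw [hfr] at hzu
    exact hH.asymm _ _ hur (adj_of_apply_eq hf₃ hr₂ hzu hr.1)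
  · obtain rfl := hd₁.eq hw hw'
    rw [hfix _ _ hf₂ hT₂.mem, hfix _ _ hf₃ hT₃.mem] at hzu
    exact hd.mem_part.1 hzu

/-- Guards must be able to enter and to leave a part of at least two vertices. -/
theorem not_forall_of_single [Finite V] (hH : IsCone H u c) (hT : IsTight H u c T)
    (hs : ∃ x, IsSingle u c T i x) (hi : (part u c i).Nontrivial) :
    ¬ (∀ x ∈ part u c i, H.Adj u x) ∧ ¬ ∀ x ∈ part u c i, H.Adj x u := by
  suffices ¬ ((∀ x ∈ part u c i, H.Adj u x) ∨ ∀ x ∈ part u c i, H.Adj x u) by tauto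
  intro hor
  -- If all arcs lead from `u`, two guards in the part could not answer an attack on `u`; if all
  -- lead to `u`, no guard can enter. Either way the part keeps a single guard.
  have hstep : ∀ S (f : V → V), IsTight H u c S → IsMultimove H S f → IsTight H u c (f '' S) →
      (∃ x, IsSingle u c S i x) → ∃ x, IsSingle u c (f '' S) i x := by
    rintro S f hS hf hT ⟨x, hx⟩
    by_contra hns
    rcases hor with h | h
    · obtain ⟨g, hg, hT', hu⟩ := hT.exists_step hH u
      obtain ⟨z, hz, hz', hzu⟩ := hH.step_from_double hT hns hg hT' hu
      exact hH.asymm _ _ (h z hz') (adj_of_apply_eq hg hz hzu hz'.1)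
    · refine hns ?_
      have key : ∀ y ∈ f '' S, y ∈ part u c i → y = f x := by
        rintro _ ⟨z, hz, rfl⟩ hy
        rcases hH.eq_or_mem_part hf hz hy with rfl | hz'
        · exact absurd (adj_of_apply_eq hf hz rfl hy.1.symm) (hH.asymm _ _ (h _ hy))
        · rw [hx.eq hz hz']
      obtain ⟨y, hy, hy'⟩ := hT.full i
      obtain rfl := key y hy hy'
      exact ⟨_, isSingle_iff.2 ⟨hy, hy', key⟩⟩
  -- Attacks on `b` and then on `a` ask the single guard to get from `b` to `a` without the arc `b →
  -- a`; an exchange through `u` needs arcs in both directions.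
  obtain ⟨a, ha, b, hb, hab, hba⟩ : ∃ a ∈ part u c i, ∃ b ∈ part u c i, a ≠ b ∧ ¬ H.Adj b a := by
    obtain ⟨a, ha, b, hb, hab⟩ := hi
    by_cases h : H.Adj b a
    · exact ⟨b, hb, a, ha, hab.symm, hH.asymm _ _ h⟩
    · exact ⟨a, ha, b, hb, hab, h⟩
  obtain ⟨f, hf, hT₁, hb₁⟩ := hT.exists_step hH b
  obtain ⟨x, hx⟩ := hstep _ _ hT hf hT₁ hs
  obtain rfl := hx.eq hb₁ hb
  obtain ⟨g, hg, hT₂, ha₂⟩ := hT₁.exists_step hH a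
  obtain ⟨y, hy⟩ := hstep _ _ hT₁ hg hT₂ ⟨_, hx⟩
  obtain rfl := hy.eq ha₂ ha
  rcases hH.single_step hg hx hy with h | h | ⟨-, -, -, h, h'⟩
  · exact hab h
  · exact hba h
  · rcases hor with h'' | h''
    · exact hH.asymm _ _ (h'' _ hb) h'
    · exact hH.asymm _ _ (h'' _ ha) h

end IsCone

end Tight

end Cone

/-! ### Sources as only guards, and the lower bound with two additional guards. -/

section Cone

variable {V ι : Type*} 
variable {H : Digraph V} {u : V} {c : V → ι} {S T : Set V} {f : V → V} {i j : ι} {x y r d e o : V}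

namespace IsCone

/-- The source `x` cannot step along an arc `x → y`: then `y`, as the only guard of the part, would
have to dominate `x`, which is not reachable from `u`. -/
theorem single_source_step (hH : IsCone H u c) (hf : IsMultimove H S f) (hT : f '' S ∈ MEDS H)
    (hx : IsSingle u c S i x) (hxu : H.Adj x u) (hy : IsSingle u c (f '' S) i y) :
    y = x ∨ (u ∈ S ∧ f u = y ∧ f x = u) := by
  rcases hH.single_step hf hx hy with h | h | ⟨h, h', h'', -⟩
  · exact Or.inl h
  · have hxy : x ≠ y := fun hxy => hH.irrefl x (hxy ▸ h)
    exact absurd (hH.adj_of_single hT hy hx.mem_part hxy (Or.inr hxu)) (hH.asymm _ _ h)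
  · exact Or.inr ⟨h, h', h''⟩

variable [Finite V] [Fintype ι]

theorem mem_of_single_source (hH : IsCone H u c) (hT : IsTight H u c T)
    (he : IsSingle u c T j e) (heu : H.Adj e u) (hj : (part u c j).Nontrivial) : u ∈ T := by
  by_contra hu
  exact hH.asymm _ _ heu (hH.adj_of_single_of_not_mem hT hu he hj)

/-- If `u` is not guarded and the part `j` has one guard, then an attack on a vertex `e` of that
part that cannot be reached from `u` forces the guards to a set containing `u` in which `e` is the
only guard of the part. -/
theorem exists_step_source (hH : IsCone H u c) (hS : IsTight H u c S) (hu : u ∉ S)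
    (hx : IsSingle u c S j x) (he : e ∈ part u c j) (heu : H.Adj e u)
    (hj : (part u c j).Nontrivial) :
    ∃ f, IsMultimove H S f ∧ IsTight H u c (f '' S) ∧ u ∈ f '' S ∧ IsSingle u c (f '' S) j e := by
  obtain ⟨f, hf, hT, heT⟩ := hS.exists_step hH e
  have h := hH.single_of_not_mem_of_mem hf hT hu hx heT he
  exact ⟨f, hf, hT, hH.mem_of_single_source hT h heu hj, h⟩

/-- As long as a vertex that cannot be reached from `u` is the only guard of the part `j`, no
other part can get a second guard. -/
theorem exists_single_of_source (hH : IsCone H u c) (hij : i ≠ j) (hj : (part u c j).Nontrivial)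
    (he : IsSingle u c S j e) (heu : H.Adj e u) (hf : IsMultimove H S f)
    (hT : IsTight H u c (f '' S)) : ∃ x, IsSingle u c (f '' S) i x := by
  refine (hT.single_or i).resolve_right fun ⟨hu, h⟩ => ?_
  obtain ⟨y, hy⟩ := h j hij.symm
  rcases hH.single_source_step hf hT.mem he heu hy with rfl | ⟨-, -, h⟩
  · exact hu (hH.mem_of_single_source hT hy heu hj)
  · exact hu ⟨e, he.mem, h⟩

/-- A vertex that cannot be reached from `u` is dominated by all other vertices of its part, if
some other part has at least two vertices. -/
theorem false_of_source_of_not_adj (hH : IsCone H u c) (hij : i ≠ j)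
    (hj : (part u c j).Nontrivial) (hd : d ∈ part u c i) (hdu : H.Adj d u) (hr : r ∈ part u c i)
    (hdr : d ≠ r) (hrd : ¬ H.Adj r d) (he : e ∈ part u c j) (heu : H.Adj e u)
    (hT : IsTight H u c T) : False := by
  -- A guard on `r` needs a second guard in the part, since `r` alone does not defend `d`.
  have key : ∀ S (f : V → V), IsMultimove H S f → IsTight H u c (f '' S) → r ∈ f '' S →
      ¬ ∃ x, IsSingle u c (f '' S) i x := by
    rintro S f hf hT hrT ⟨x, hx⟩
    obtain rfl := hx.eq hrT hr
    exact hrd (hH.adj_of_single hT.mem hx hd hdr (Or.inr hdu))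
  obtain ⟨f₁, hf₁, hT₁, hr₁⟩ := hT.exists_step hH r
  obtain ⟨hu₁, h₁⟩ := (hT₁.single_or i).resolve_left (key _ _ hf₁ hT₁ hr₁)
  obtain ⟨x, hx⟩ := h₁ j hij.symm
  -- Making `e` the only guard of the part `j` rules out a second guard in the part `i`, so a new
  -- attack on `r` is fatal.
  obtain ⟨f₂, hf₂, hT₂, hu₂, he₂⟩ := hH.exists_step_source hT₁ hu₁ hx he heu hj
  obtain ⟨f₃, hf₃, hT₃, hr₃⟩ := hT₂.exists_step hH r
  exact key _ _ hf₃ hT₃ hr₃ (hH.exists_single_of_source hij hj he₂ heu hf₃ hT₃)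

/-- The case of at least two targets in the part `i`, as expressed by `hout`. With `e` the only
guard of the part `j`, the part `i` has a single guard and keeps one in the next move; walking this
guard between targets forces arcs in both directions. -/
theorem false_of_two_targets (hH : IsCone H u c) (hij : i ≠ j) (hi : (part u c i).Nontrivial)
    (hj : (part u c j).Nontrivial) (hd : d ∈ part u c i) (hdu : H.Adj d u)
    (hout : ∀ o ∈ part u c i, ∃ o' ∈ part u c i, o' ≠ o ∧ H.Adj u o')
    (he : e ∈ part u c j) (heu : H.Adj e u)
    (hT : IsTight H u c T) : False := by
  -- A target cannot be exchanged through `u`, so its guard must step along an arc to the attacked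
  -- target.
  have hA : ∀ T o o', IsTight H u c T → IsSingle u c T i o → IsSingle u c T j e → H.Adj u o →
      o' ∈ part u c i → o' ≠ o → H.Adj u o' →
      ∃ f, IsMultimove H T f ∧ IsTight H u c (f '' T) ∧ IsSingle u c (f '' T) i o' ∧
        H.Adj o o' := by
    intro T o o' hT ho he huo ho' hne huo'
    obtain ⟨f, hf, hT', hm⟩ := hT.exists_step hH o'
    obtain ⟨x, hx⟩ := hH.exists_single_of_source hij hj he heu hf hT'
    obtain rfl := hx.eq hm ho'
    refine ⟨f, hf, hT', hx, ?_⟩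
    rcases hH.single_step hf ho hx with h | h | ⟨-, -, -, -, h⟩
    · exact absurd h hne
    · exact h
    · exact absurd h (hH.asymm _ _ huo)
  -- A source must be exchanged through `u`. This uses the guard of `u`, so `e` stays the only guard
  -- of the part `j`.
  have hB : ∀ T d o, IsTight H u c T → IsSingle u c T i d → IsSingle u c T j e → H.Adj d u →
      o ∈ part u c i → H.Adj u o →
      ∃ T', IsTight H u c T' ∧ IsSingle u c T' i o ∧ IsSingle u c T' j e := by
    intro T d o hT hd he hdu ho huo
    obtain ⟨f, hf, hT', hm⟩ := hT.exists_step hH o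
    obtain ⟨x, hx⟩ := hH.exists_single_of_source hij hj he heu hf hT'
    obtain rfl := hx.eq hm ho
    rcases hH.single_source_step hf hT'.mem hd hdu hx with rfl | ⟨-, hfu, hfd⟩
    · exact absurd hdu (hH.asymm _ _ huo)
    · obtain ⟨y, hy⟩ := hT'.exists_single (Set.mem_image_of_mem f hd.mem |> fun h => hfd ▸ h) j
      rcases hH.single_source_step hf hT'.mem he heu hy with rfl | ⟨-, hfu', -⟩
      · exact ⟨_, hT', hx, hy⟩
      · exact absurd (hx.mem_part.2.symm.trans (by rw [← hfu, hfu', hy.mem_part.2])) hij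
  -- A target `o` and `e` cannot be the only guards of their parts. Attack another target `o'`,
  -- which forces `o → o'`, and then `e`: every possible position of the guard of the part `i` is
  -- contradictory.
  have hC : ∀ T o, IsTight H u c T → IsSingle u c T i o → IsSingle u c T j e → ¬ H.Adj u o := by
    intro T o hT ho he₀ huo
    obtain ⟨o', ho', hne, huo'⟩ := hout o ho.mem_part
    obtain ⟨f₁, hf₁, hT₁, h₁, hoo'⟩ := hA T o o' hT ho he₀ huo ho' hne huo'
    have hno : ∀ T, IsTight H u c T → IsSingle u c T i o' → ¬ IsSingle u c T j e := by
      intro T hT h h'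
      obtain ⟨-, -, -, -, h''⟩ := hA T o' o hT h h' huo' ho.mem_part hne.symm huo
      exact hH.asymm _ _ hoo' h''
    obtain ⟨f₂, hf₂, hT₂, he₂⟩ := hT₁.exists_step hH e
    -- A second guard in the part `j` would leave `u` unguarded; then the guard of the part `i` is
    -- still on `o'` and would have to dominate `o`, against `o → o'`.
    have hs : IsSingle u c (f₂ '' (f₁ '' T)) j e := by
      by_contra hc
      have hns : ¬ ∃ x, IsSingle u c (f₂ '' (f₁ '' T)) j x := by
        rintro ⟨x, hx⟩
        exact hc (hx.eq he₂ he ▸ hx)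
      obtain ⟨hu₂, h₂⟩ := (hT₂.single_or j).resolve_left hns
      obtain ⟨y, hy⟩ := h₂ i hij
      have hyo : y = o' := by
        by_contra hyo
        have h3 := hH.adj_of_single hT₂.mem hy h₁.mem_part (Ne.symm hyo) (Or.inl hu₂)
        rcases hH.single_step hf₂ h₁ hy with h | h | ⟨-, -, -, -, h⟩
        · exact hyo h
        · exact hH.asymm _ _ h h3
        · exact hH.asymm _ _ h huo'
      subst hyo
      exact hH.asymm _ _ hoo' (hH.adj_of_single hT₂.mem hy ho.mem_part hne.symm (Or.inl hu₂))
    have hu₂ := hH.mem_of_single_source hT₂ hs heu hj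
    obtain ⟨y, hy⟩ := hT₂.exists_single hu₂ i
    have hyo : y ≠ o' := by
      rintro rfl
      exact hno _ hT₂ hy hs
    rcases hH.star y hy.mem_part.1 with h | h
    · obtain ⟨-, -, -, -, h3⟩ := hA _ y o' hT₂ hy hs h ho' hyo.symm huo'
      rcases hH.single_step hf₂ h₁ hy with h | h | ⟨-, -, -, -, h⟩
      · exact hyo h
      · exact hH.asymm _ _ h h3
      · exact hH.asymm _ _ h huo'
    · obtain ⟨T', hT', h', h''⟩ := hB _ y o' hT₂ hy hs h ho' huo'
      exact hno _ hT' h' h''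
  -- By `hB` a source in the part `i` can be turned into a target, so `hC` excludes all sets in
  -- which `e` is an only guard.
  have hD : ∀ T, IsTight H u c T → ¬ IsSingle u c T j e := by
    intro T hT he₀
    obtain ⟨x, hx⟩ := hT.exists_single (hH.mem_of_single_source hT he₀ heu hj) i
    rcases hH.star x hx.mem_part.1 with h | h
    · exact hC T x hT hx he₀ h
    · obtain ⟨o, ho, -, huo⟩ := hout x hx.mem_part
      obtain ⟨T', hT', h', h''⟩ := hB T x o hT hx he₀ h ho huo
      exact hC T' o hT' h' h'' huo
  -- After an attack on the source `d`, either it pins the part `j` to one guard or the part `i`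
  -- holds both spare places; in both cases an attack on `e` contradicts `hD`.
  obtain ⟨f₁, hf₁, hT₁, hd₁⟩ := hT.exists_step hH d
  rcases hT₁.single_or i with ⟨x, hx⟩ | ⟨hu₁, h₁⟩
  · obtain rfl := hx.eq hd₁ hd
    obtain ⟨f₂, hf₂, hT₂, he₂⟩ := hT₁.exists_step hH e
    obtain ⟨y, hy⟩ := hH.exists_single_of_source hij.symm hi hx hdu hf₂ hT₂
    exact hD _ hT₂ (hy.eq he₂ he ▸ hy)
  · obtain ⟨y, hy⟩ := h₁ j hij.symm
    obtain ⟨f₂, hf₂, hT₂, -, he₂⟩ := hH.exists_step_source hT₁ hu₁ hy he heu hj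
    exact hD _ hT₂ he₂

/-- Both parts contain sources, as guards must be able to enter them. Two sources in the part `i`
are joined by at most one arc, so one does not dominate the other; with only one source, three
vertices leave two targets. -/
theorem card_add_two_le (hH : IsCone H u c) (hij : i ≠ j) (hi : 3 ≤ (part u c i).ncard)
    (hj : 2 ≤ (part u c j).ncard) (hS : S ∈ MEDS H) : Fintype.card ι + 2 ≤ S.ncard := by
  by_contra hlt
  obtain ⟨T, hT, hTS, hu, hfull⟩ := hH.exists_full hS
  have hT : IsTight H u c T := ⟨hT, by have := hH.card_add_one_le hS; omega, hfull⟩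
  have hj := Set.one_lt_ncard_iff_nontrivial.1 hj
  have hi' : (part u c i).Nontrivial := Set.one_lt_ncard_iff_nontrivial.1 (by omega)
  obtain ⟨h1, h2⟩ := hH.not_forall_of_single hT (hT.exists_single hu j) hj
  obtain ⟨h3, h4⟩ := hH.not_forall_of_single hT (hT.exists_single hu i) hi'
  push Not at h1 h3 h4
  obtain ⟨e, he, hue⟩ := h1
  obtain ⟨d, hd, hud⟩ := h3
  have heu := (hH.star e he.1).resolve_left hue
  have hdu := (hH.star d hd.1).resolve_left hud
  by_cases hsrc : ∃ r ∈ part u c i, H.Adj r u ∧ r ≠ d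
  · obtain ⟨r, hr, hru, hrd⟩ := hsrc
    by_cases h : H.Adj r d
    · exact hH.false_of_source_of_not_adj hij hj hr hru hd hrd (hH.asymm _ _ h) he heu hT
    · exact hH.false_of_source_of_not_adj hij hj hd hdu hr hrd.symm h he heu hT
  · push Not at hsrc
    refine hH.false_of_two_targets hij hi' hj hd hdu (fun o ho => ?_) he heu hT
    by_contra! hc
    have hsub : part u c i ⊆ {d, o} := fun x hx => by
      by_cases hxo : x = o
      · exact Or.inr hxo
      · exact Or.inl (hsrc x hx ((hH.star x hx.1).resolve_left (hc x hx hxo)))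
    have := (Set.ncard_le_ncard hsub).trans (Set.ncard_insert_le d {o})
    rw [Set.ncard_singleton] at this
    omega

end IsCone

end Cone

/-! ### Strategies that rotate guards along the triangles through `u`. -/

section Upper

variable {V ι : Type*} {G : SimpleGraph V} {u : V} {c : V → ι} {v : ι → V}

/-- The digraph with the arcs `u → x → v i → u` for every part `i` and every vertex `x` of this
part other than `v i`. -/
def triangleDigraph (u : V) (c : V → ι) (v : ι → V) : Digraph V :=
  ⟨fun x y => (x = u ∧ y ≠ u ∧ y ∉ Set.range v) ∨ (x ≠ u ∧ x ∉ Set.range v ∧ y = v (c x)) ∨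
    (x ∈ Set.range v ∧ y = u)⟩

theorem triangleDigraph_asymm (hv : ∀ i, v i ∈ part u c i) (x y : V)
    (h : (triangleDigraph u c v).Adj x y) : ¬ (triangleDigraph u c v).Adj y x := by
  have hv' : ∀ i, v i ≠ u := fun i => (hv i).1
  rintro h'
  rcases h with ⟨h0, h1, h2⟩ | ⟨h0, h1, h2⟩ | ⟨h0, h1⟩ <;>
    rcases h' with ⟨h3, h4, h5⟩ | ⟨h3, h4, h5⟩ | ⟨h3, h4⟩
  · exact h1 h3
  · exact hv' _ (h5.symm.trans h0)
  · exact h2 h3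
  · exact hv' _ (h2.symm.trans h3)
  · exact h4 ⟨_, h2.symm⟩
  · exact h0 h4
  · exact h5 h0
  · exact h3 h1
  · obtain ⟨j, hj⟩ := h3
    exact hv' j (hj.trans h1)

theorem triangleDigraph_le (hv : ∀ i, v i ∈ part u c i)
    (hadj : ∀ i, ∀ x ∈ part u c i, x ≠ v i → G.Adj x (v i)) (hu : G.IsUniversal u) (x y : V)
    (h : (triangleDigraph u c v).Adj x y) : G.Adj x y := by
  rcases h with ⟨rfl, h1, h2⟩ | ⟨h1, h2, rfl⟩ | ⟨⟨i, rfl⟩, rfl⟩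
  · exact hu h1.symm
  · exact hadj _ x ⟨h1, rfl⟩ fun h => h2 ⟨_, h.symm⟩
  · exact (hu (hv i).1.symm).symm

theorem injective_of_mem_part (hv : ∀ i, v i ∈ part u c i) : Function.Injective v :=
  fun i j h => (hv i).2.symm.trans ((congrArg c h).trans (hv j).2)

theorem ncard_insert_range [Finite V] [Fintype ι] (hv : ∀ i, v i ∈ part u c i) :
    (insert u (Set.range v)).ncard = Fintype.card ι + 1 := by
  rw [Set.ncard_insert_of_notMem, ← Set.image_univ,
    Set.ncard_image_of_injective _ (injective_of_mem_part hv), Set.ncard_univ,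
    Nat.card_eq_fintype_card]
  rintro ⟨i, hi⟩
  exact (hv i).1 hi

/-- Invariant: guards on `u`, on all `v i`, and one roving guard `w`. An attack on `r` is answered
by `u → r`, `v (c w) → u` and `w → v (c w)`. -/
theorem orientedMEternalNumber_le_card_add_two [Finite V] [Fintype ι]
    (hv : ∀ i, v i ∈ part u c i) (hadj : ∀ i, ∀ x ∈ part u c i, x ≠ v i → G.Adj x (v i))
    (hu : G.IsUniversal u) {w₀ : V} (hw₀ : w₀ ≠ u) (hw₀' : w₀ ∉ Set.range v) :
    orientedMEternalNumber G ≤ Fintype.card ι + 2 := by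
  classical
  have hS : insert w₀ (insert u (Set.range v)) ∈ MEDS (triangleDigraph u c v) := by
    refine subset_MEDS (F := {S | ∃ w, w ≠ u ∧ w ∉ Set.range v ∧
      S = insert w (insert u (Set.range v))}) ?_ ⟨w₀, hw₀, hw₀', rfl⟩
    rintro _ ⟨w, hwu, hwv, rfl⟩ r hr
    simp only [Set.mem_insert_iff, not_or] at hr
    obtain ⟨hrw, hru, hrv⟩ := hr
    replace hru : r ≠ u := hru
    have hvu : ∀ i, v i ≠ u := fun i => (hv i).1
    have hvw : ∀ i, v i ≠ w := fun i h => hwv ⟨i, h⟩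
    have hvr : ∀ i, v i ≠ r := fun i h => hrv ⟨i, h⟩
    have hinj := injective_of_mem_part hv
    let f : V → V := fun x =>
      if x = u then r else if x = w then v (c w) else if x = v (c w) then u else x
    -- A left inverse of `f` on the guards, which proves injectivity.
    let g : V → V := fun x =>
      if x = r then u else if x = u then v (c w) else if x = v (c w) then w else x
    have hgf : Set.LeftInvOn g f (insert w (insert u (Set.range v))) := by
      rintro x (rfl | rfl | ⟨i, rfl⟩)
      · simp [f, g, hwu, hvr, hvu]
      · simp [f, g]
      · by_cases hi : v i = v (c w)
        · simp [f, g, hi, hvu, hvw, hru.symm]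
        · simp [f, g, hi, hvu, hvw, hvr]
    have himg : f '' insert w (insert u (Set.range v)) = insert r (insert u (Set.range v)) := by
      ext y
      constructor
      · rintro ⟨x, rfl | rfl | ⟨i, rfl⟩, rfl⟩
        · simp [f, hwu]
        · simp [f]
        · by_cases hi : v i = v (c w)
          · simp [f, hi, hvu, hvw]
          · simp [f, hi, hvu, hvw]
      · rintro (rfl | rfl | ⟨i, rfl⟩)
        · exact ⟨u, by simp, by simp [f]⟩
        · exact ⟨v (c w), by simp, by simp [f, hvu, hvw]⟩
        · by_cases hi : v i = v (c w)
          · exact ⟨w, by simp, by simp [f, hwu, hi]⟩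
          · exact ⟨v i, by simp, by simp [f, hvu, hvw, hi]⟩
    refine ⟨f, ⟨hgf.injOn, ?_⟩, ?_, ?_⟩
    · rintro x (rfl | rfl | ⟨i, rfl⟩)
      · exact Or.inr (Or.inr (Or.inl ⟨hwu, hwv, by simp [f, hwu]⟩))
      · exact Or.inr (Or.inl ⟨rfl, by simpa [f] using hru, by simpa [f] using hrv⟩)
      · by_cases hi : v i = v (c w)
        · exact Or.inr (Or.inr (Or.inr ⟨⟨i, rfl⟩, by simp [f, hi, hvu, hvw]⟩))
        · exact Or.inl (by simp [f, hi, hvu, hvw])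
    · rw [himg]; exact Or.inl rfl
    · exact ⟨r, hru, hrv, himg⟩
  refine (orientedMEternalNumber_le (triangleDigraph_le hv hadj hu)
    (triangleDigraph_asymm hv) hS).trans ((Set.ncard_insert_le _ _).trans ?_)
  rw [ncard_insert_range hv]

/-- Invariant: guards on `u` and on one vertex `t i` of every part. In a part of at most two
vertices the guard either stands on `v i`, and rotates with the guard of `u`, or can step to `v i`.
-/
theorem orientedMEternalNumber_le_card_add_one [Finite V] [Fintype ι]
    (hv : ∀ i, v i ∈ part u c i) (hadj : ∀ i, ∀ x ∈ part u c i, x ≠ v i → G.Adj x (v i))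
    (hu : G.IsUniversal u) (h2 : ∀ i, (part u c i).ncard ≤ 2) :
    orientedMEternalNumber G ≤ Fintype.card ι + 1 := by
  classical
  have hS : insert u (Set.range v) ∈ MEDS (triangleDigraph u c v) := by
    refine subset_MEDS (F := {S | ∃ t : ι → V, (∀ i, t i ∈ part u c i) ∧
      S = insert u (Set.range t)}) ?_ ⟨v, hv, rfl⟩
    rintro _ ⟨t, ht, rfl⟩ r hr
    simp only [Set.mem_insert_iff, not_or] at hr
    obtain ⟨hru, hrt⟩ := hr
    replace hru : r ≠ u := hru
    have htu : ∀ i, t i ≠ u := fun i => (ht i).1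
    have htr : ∀ i, t i ≠ r := fun i h => hrt ⟨i, h⟩
    have hinj := injective_of_mem_part ht
    have hnv : ∀ x ∈ part u c (c r), x ≠ v (c r) → x ∉ Set.range v := by
      rintro _ hx hne ⟨i, rfl⟩
      exact hne (by rw [← (hv i).2.symm.trans hx.2])
    have ht' : ∀ i, Function.update t (c r) r i ∈ part u c i := fun i => by
      by_cases hi : i = c r
      · subst hi; simpa using ⟨hru, rfl⟩
      · simpa [hi] using ht i
    by_cases htv : t (c r) = v (c r)
    · let f : V → V := fun x => if x = u then r else if x = t (c r) then u else x
      let g : V → V := fun x => if x = r then u else if x = u then t (c r) else x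
      have hrv : r ∉ Set.range v := hnv r ⟨hru, rfl⟩ fun h => htr (c r) (htv.trans h.symm)
      have hgf : Set.LeftInvOn g f (insert u (Set.range t)) := by
        rintro x (rfl | ⟨i, rfl⟩)
        · simp [f, g]
        · by_cases hi : t i = t (c r)
          · simp [f, g, hi, htu, hru.symm]
          · simp [f, g, hi, htu, htr]
      have himg : f '' insert u (Set.range t) =
          insert u (Set.range (Function.update t (c r) r)) := by
        ext y
        constructor
        · rintro ⟨x, rfl | ⟨i, rfl⟩, rfl⟩
          · exact Or.inr ⟨c r, by simp [f]⟩
          · by_cases hi : i = c r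
            · exact Or.inl (by simp [f, hi, htu])
            · exact Or.inr ⟨i, by simp [f, hi, htu, hinj.eq_iff]⟩
        · rintro (rfl | ⟨i, rfl⟩)
          · exact ⟨t (c r), by simp, by simp [f, htu]⟩
          · by_cases hi : i = c r
            · exact ⟨u, by simp, by simp [f, hi]⟩
            · exact ⟨t i, by simp, by simp [f, hi, htu, hinj.eq_iff]⟩
      refine ⟨f, ⟨hgf.injOn, ?_⟩, ?_, ?_⟩
      · rintro x (rfl | ⟨i, rfl⟩)
        · exact Or.inr (Or.inl ⟨rfl, by simpa [f] using hru, by simpa [f] using hrv⟩)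
        · by_cases hi : i = c r
          · subst hi
            exact Or.inr (Or.inr (Or.inr ⟨⟨_, htv.symm⟩, by simp [f, htu]⟩))
          · exact Or.inl (by simp [f, hi, htu, hinj.eq_iff])
      · exact ⟨u, by simp, by simp [f]⟩
      · exact ⟨_, ht', himg⟩
    -- The part has at most two vertices, and `t (c r)` differs from both `r` and `v (c r)`.
    · have hrv : r = v (c r) := by
        by_contra hne
        have hsub : ({r, t (c r), v (c r)} : Set V) ⊆ part u c (c r) := by
          rintro x (rfl | rfl | rfl)
          exacts [⟨hru, rfl⟩, ht _, hv _]
        have := (Set.ncard_le_ncard hsub).trans (h2 _)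
        rw [Set.ncard_eq_three.2 ⟨_, _, _, (htr _).symm, hne, htv, rfl⟩] at this
        omega
      let f : V → V := fun x => if x = t (c r) then r else x
      let g : V → V := fun x => if x = r then t (c r) else x
      have hgf : Set.LeftInvOn g f (insert u (Set.range t)) := by
        rintro x (rfl | ⟨i, rfl⟩)
        · simp [f, g, (htu _).symm, hru.symm]
        · by_cases hi : t i = t (c r)
          · simp [f, g, hi]
          · simp [f, g, hi, htr]
      have himg : f '' insert u (Set.range t) =
          insert u (Set.range (Function.update t (c r) r)) := by
        ext y
        constructor
        · rintro ⟨x, rfl | ⟨i, rfl⟩, rfl⟩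
          · exact Or.inl (by simp [f, (htu _).symm])
          · by_cases hi : i = c r
            · exact Or.inr ⟨c r, by simp [f, hi]⟩
            · exact Or.inr ⟨i, by simp [f, hi, hinj.eq_iff]⟩
        · rintro (rfl | ⟨i, rfl⟩)
          · exact ⟨_, Or.inl rfl, by simp [f, (htu _).symm]⟩
          · by_cases hi : i = c r
            · exact ⟨t i, by simp, by simp [f, hi]⟩
            · exact ⟨t i, by simp, by simp [f, hi, hinj.eq_iff]⟩
      refine ⟨f, ⟨hgf.injOn, ?_⟩, ?_, ?_⟩
      · rintro x (rfl | ⟨i, rfl⟩)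
        · exact Or.inl (by simp [f, (htu _).symm])
        · by_cases hi : i = c r
          · subst hi
            refine Or.inr (Or.inr (Or.inl ⟨htu _, hnv _ (ht _) htv, ?_⟩))
            simpa [f, (ht (c r)).2] using hrv
          · exact Or.inl (by simp [f, hi, hinj.eq_iff])
      · exact ⟨t (c r), by simp, by simp [f]⟩
      · exact ⟨_, ht', himg⟩
  refine (orientedMEternalNumber_le (triangleDigraph_le hv hadj hu)
    (triangleDigraph_asymm hv) hS).trans ?_
  rw [ncard_insert_range hv]

end Upper

/-! ### Removal of leaves. -/

section Leaves

variable {V : Type*} {G : SimpleGraph V} {H : Digraph V} {u : V} {W : Set V}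

/-- Removing leaves that hang at the same vertex `u` lowers the oriented m-eternal domination
number by at least their number: once all leaves have been attacked, they stay guarded. -/
theorem orientedMEternalNumber_induce_compl_add_le [Finite V] (hu : u ∉ W)
    (hW : ∀ w ∈ W, ∀ x, G.Adj x w → x = u) :
    orientedMEternalNumber (G.induce Wᶜ) + W.ncard ≤ orientedMEternalNumber G := by
  refine le_orientedMEternalNumber fun H hH S hS => ?_
  have hin : ∀ w ∈ W, ∀ x, H.Adj x w → x = u := fun w hw x h => hW w hw x ((hH.1 _ _).2 (Or.inl h))
  have hout : ∀ w ∈ W, ∀ x, H.Adj w x → x = u := fun w hw x h =>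
    hW w hw x ((hH.1 _ _).2 (Or.inr h))
  -- A guard leaving the leaf `w` uses `w → u`; then `w` could never be entered again, as this needs
  -- `u → w`.
  have hfix : ∀ (T : Set V) (f : V → V), IsMultimove H T f → f '' T ∈ MEDS H →
      ∀ w ∈ W, w ∈ T → w ∈ f '' T := by
    intro T f hf hT w hw hwT
    by_contra hc
    obtain ⟨T', -, hwT', g, hg, rfl⟩ := exists_step_of_mem_MEDS hT w
    obtain ⟨z, hz, hzw⟩ := hwT'
    have hzw' : H.Adj z w := (hzw ▸ hg.2 z hz).resolve_left fun h => hc (h ▸ hz)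
    obtain rfl := hin w hw z hzw'
    have hwf : H.Adj w (f w) := (hf.2 w hwT).resolve_left fun h => hc ⟨w, hwT, h⟩
    rw [hout w hw _ hwf] at hwf
    exact hH.2 _ _ ⟨hzw', hwf⟩
  obtain ⟨T, ⟨hT, hTS⟩, hmax⟩ := (Set.toFinite {T | T ∈ MEDS H ∧ T.ncard = S.ncard}).exists_maximalFor
    (fun T => W ∩ T) _ ⟨S, hS, rfl⟩
  have hWT : W ⊆ T := fun w hw => by
    obtain ⟨T', hT', hwT', f, hf, rfl⟩ := exists_step_of_mem_MEDS hT w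
    exact (hmax (j := f '' T) ⟨hT', hf.1.ncard_image.trans hTS⟩
      (fun x hx => ⟨hx.1, hfix T f hf hT' x hx.1 hx.2⟩) ⟨hw, hwT'⟩).2
  have hpre : ((↑) ⁻¹' T : Set ↥Wᶜ) ∈ MEDS (restrict H Wᶜ) := by
    refine preimage_mem_MEDS_restrict (F := {T | T ∈ MEDS H ∧ W ⊆ T}) ?_ ⟨hT, hWT⟩
    rintro T ⟨hT, hWT⟩ r - hrT
    obtain ⟨f, hf, hrf, hT'⟩ := closedUnderDefense_MEDS H T hT r hrT
    have hWT' : W ⊆ f '' T := fun w hw => hfix T f hf hT' w hw (hWT hw)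
    -- The guard on a leaf is not even exchanged, since leaving and entering would need both
    -- directions of the edge to `u`.
    have hid : ∀ w ∈ W, f w = w := fun w hw => by
      by_contra hne
      have hwf := (hf.2 w (hWT hw)).resolve_left hne
      obtain ⟨z, hz, hzw⟩ := hWT' hw
      have hzne : z ≠ w := by rintro rfl; exact hne hzw
      have hzw' : H.Adj z w := (hzw ▸ hf.2 z hz).resolve_left hzne.symm
      rw [hin w hw z hzw'] at hzw'
      rw [hout w hw _ hwf] at hwf
      exact hH.2 _ _ ⟨hzw', hwf⟩
    refine ⟨f, hf, hrf, ⟨hT', hWT'⟩, fun x hx => not_congr ⟨fun h => ?_, fun h => ?_⟩⟩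
    · have : x = f x := hf.1 hx (hWT h) (hid _ h).symm
      rwa [this]
    · rwa [hid x h]
  refine (Nat.add_le_add_right
    (orientedMEternalNumber_le_of_isOrientation (hH.restrict _) hpre) _).trans ?_
  rw [ncard_preimage_val, ← hTS, ← Set.sdiff_eq, Set.ncard_sdiff_add_ncard_of_subset hWT]

end Leaves

/-! ### Graphs defended by two guards. -/

section TwoGuards

variable {V : Type*} {G : SimpleGraph V} {H D : Digraph V} {S : Set V}

theorem exists_pair_step {a b r : V} (h : {a, b} ∈ MEDS H) (hra : r ≠ a) (hrb : r ≠ b) :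
    ∃ c, {r, c} ∈ MEDS H ∧
      ((H.Adj a r ∧ (c = b ∨ H.Adj b c)) ∨ (H.Adj b r ∧ (c = a ∨ H.Adj a c))) := by
  obtain ⟨T, hT, hrT, f, hf, rfl⟩ := exists_step_of_mem_MEDS h r
  rw [Set.image_pair] at hT hrT
  rcases hrT with rfl | rfl
  · exact ⟨f b, hT, Or.inl ⟨(hf.2 a (by simp)).resolve_left hra, hf.2 b (by simp)⟩⟩
  · rw [Set.pair_comm] at hT
    exact ⟨f a, hT, Or.inr ⟨(hf.2 b (by simp)).resolve_left hrb, hf.2 a (by simp)⟩⟩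

/-- The guard on `d` is useless against an attack on `a`, so the other guard must answer it. -/
theorem eq_or_adj_of_pair {a d x : V} (hd : ¬ H.Adj d a) (hda : a ≠ d) (h : {d, x} ∈ MEDS H) :
    x = a ∨ H.Adj x a := by
  by_cases hx : x = a
  · exact Or.inl hx
  obtain ⟨c, -, ⟨h, -⟩ | ⟨h, -⟩⟩ := exists_pair_step h hda (Ne.symm hx)
  · exact absurd h hd
  · exact Or.inr h

/-- Two guards do not suffice if some vertex `d` has two non-neighbors. -/
theorem three_le_ncard_of_not_adj [Finite V] (hH : ∀ x y, H.Adj x y → ¬ H.Adj y x)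
    {a b d : V} (hab : a ≠ b) (ha : a ≠ d) (hb : b ≠ d) (hda : ¬ H.Adj d a) (had : ¬ H.Adj a d)
    (hdb : ¬ H.Adj d b) (hbd : ¬ H.Adj b d) (hS : S ∈ MEDS H) : 3 ≤ S.ncard := by
  by_contra hlt
  obtain ⟨T, hT, hdT, hST⟩ := exists_step_of_mem_MEDS hS d
  have hTS := hST.ncard_eq
  -- The choice `x = d` covers a single guard.
  obtain ⟨x, hx⟩ : ∃ x, T = {d, x} := by
    have h1 := Set.ncard_sdiff_singleton_add_one hdT
    have h2 : (T \ {d}).ncard ≤ 1 := by omega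
    rcases (Set.ncard_le_one_iff_eq (Set.toFinite _)).1 h2 with h | ⟨x, h⟩
    · exact ⟨d, by rw [← Set.insert_sdiff_self_of_mem hdT, h]; simp⟩
    · exact ⟨x, by rw [← Set.insert_sdiff_self_of_mem hdT, h]⟩
  subst hx
  -- The attack on `t` is answered from `x`. If the guard on `d` moved along `d → c`, then the guard
  -- on `c` would have to defend `d`, against the direction of this arc; so it stays.
  have key : ∀ x t, {d, x} ∈ MEDS H → t ≠ d → t ≠ x → ¬ H.Adj d t → ¬ H.Adj t d →
      {d, t} ∈ MEDS H := by
    intro x t h htd htx hdt htd'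
    obtain ⟨c, hc, ⟨h1, -⟩ | ⟨-, h2⟩⟩ := exists_pair_step h htd htx
    · exact absurd h1 hdt
    · have : c = d := by
        rcases h2 with h2 | h2
        · exact h2
        · exact (eq_or_adj_of_pair htd' htd.symm hc).resolve_right (hH _ _ h2)
      rwa [this, Set.pair_comm] at hc
  have hTa : {d, a} ∈ MEDS H := by
    by_cases h : a = x
    · rwa [h]
    · exact key x a hT ha h hda had
  have hTb := key a b hTa hb hab.symm hdb hbd
  -- From `{d, a}` the vertex `b` must be defended by `a`, and from `{d, b}` the vertex `a` by `b`.
  exact hH _ _ ((eq_or_adj_of_pair hdb hb hTa).resolve_left hab)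
    ((eq_or_adj_of_pair hda ha hTb).resolve_left hab.symm)

/-- Here `Q` lists the admissible pairs of guards, up to their order. -/
theorem pair_mem_MEDS {Q : V → V → Prop} (hne : ∀ a b, Q a b → a ≠ b)
    (hQ : ∀ a b, Q a b → ∀ r, r ≠ a → r ≠ b → ∃ c, (Q r c ∨ Q c r) ∧
      ((D.Adj a r ∧ (c = b ∨ D.Adj b c)) ∨ (D.Adj b r ∧ (c = a ∨ D.Adj a c))))
    {a b : V} (h : Q a b) : {a, b} ∈ MEDS D := by
  classical
  refine subset_MEDS (F := {S | ∃ a b, Q a b ∧ S = {a, b}}) ?_ ⟨a, b, h, rfl⟩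
  clear h a b
  have key : ∀ a b r c, a ≠ b → r ≠ c → D.Adj a r → (c = b ∨ D.Adj b c) → (Q r c ∨ Q c r) →
      ∃ f, IsMultimove D {a, b} f ∧ r ∈ f '' {a, b} ∧
        f '' {a, b} ∈ {S | ∃ a b, Q a b ∧ S = {a, b}} := by
    intro a b r c hab hrc har hbc hq
    let f : V → V := fun x => if x = a then r else c
    have hfa : f a = r := if_pos rfl
    have hfb : f b = c := if_neg hab.symm
    refine ⟨f, ⟨?_, ?_⟩, ?_, ?_⟩
    · rintro x (rfl | rfl) y (rfl | rfl) h
      · rfl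
      · exact absurd (hfa.symm.trans (h.trans hfb)) hrc
      · exact absurd (hfa.symm.trans (h.symm.trans hfb)) hrc
      · rfl
    · rintro x (rfl | rfl)
      · exact Or.inr (by rwa [hfa])
      · rw [hfb]; exact hbc
    · exact ⟨a, by simp, hfa⟩
    · rw [Set.image_pair, hfa, hfb]
      rcases hq with hq | hq
      · exact ⟨r, c, hq, rfl⟩
      · exact ⟨c, r, hq, Set.pair_comm _ _⟩
  rintro _ ⟨a, b, hab, rfl⟩ r hr
  simp only [Set.mem_insert_iff, Set.mem_singleton_iff, not_or] at hr
  obtain ⟨c, hq, h⟩ := hQ a b hab r hr.1 hr.2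
  have hrc : r ≠ c := hq.elim (hne _ _) fun h => (hne _ _ h).symm
  rcases h with ⟨h1, h2⟩ | ⟨h1, h2⟩
  · exact key a b r c (hne _ _ hab) hrc h1 h2 hq
  · rw [Set.pair_comm]
    exact key b a r c (hne _ _ hab).symm hrc h1 h2 hq

theorem exists_equiv_fin [Finite V] {n : ℕ} (hn : Nat.card V = n) {p q : V} (hpq : p ≠ q)
    (i j : Fin n) (hij : i ≠ j) : ∃ e : V ≃ Fin n, e p = i ∧ e q = j := by
  classical
  obtain ⟨e⟩ : Nonempty (V ≃ Fin n) := ⟨hn ▸ Finite.equivFin V⟩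
  obtain ⟨e', h1⟩ : ∃ e' : V ≃ Fin n, e' p = i := ⟨e.trans (Equiv.swap (e p) i), by simp⟩
  refine ⟨e'.trans (Equiv.swap (e' q) j), ?_, by simp⟩
  rw [Equiv.trans_apply]
  exact (Equiv.swap_apply_of_ne_of_ne (fun h => hpq (e'.injective h)) (h1 ▸ hij)).trans h1

/-- A defense strategy with two guards on a digraph with the vertices `0, …, n - 1`. -/
theorem orientedMEternalNumber_le_two_of_strategy {n : ℕ} (e : V ≃ Fin n) {R Q : ℕ → ℕ → Prop}
    (hR : ∀ i j, R i j → ¬ R j i) (hG : ∀ x y, R (e x) (e y) → G.Adj x y)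
    (hne : ∀ i j, Q i j → i ≠ j)
    (hQ : ∀ i j r, i < n → j < n → r < n → Q i j → r ≠ i → r ≠ j → ∃ c, c < n ∧ (Q r c ∨ Q c r) ∧
      ((R i r ∧ (c = j ∨ R j c)) ∨ (R j r ∧ (c = i ∨ R i c))))
    {i j : ℕ} (hi : i < n) (hj : j < n) (hij : Q i j) : orientedMEternalNumber G ≤ 2 := by
  have hmem : {e.symm ⟨i, hi⟩, e.symm ⟨j, hj⟩} ∈ MEDS (⟨fun x y => R (e x) (e y)⟩ : Digraph V) := by
    refine pair_mem_MEDS (Q := fun x y => Q (e x) (e y)) (fun a b h hab => hne _ _ h (by rw [hab]))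
      (fun a b hab r hra hrb => ?_) (by simpa using hij)
    have hne' : ∀ x y : V, x ≠ y → (e x : ℕ) ≠ e y := fun x y h h' => h (e.injective (Fin.ext h'))
    obtain ⟨c, hc, h1, h2⟩ := hQ _ _ (e r) (e a).2 (e b).2 (e r).2 hab (hne' _ _ hra) (hne' _ _ hrb)
    refine ⟨e.symm ⟨c, hc⟩, by simpa using h1, ?_⟩
    simpa [Equiv.symm_apply_eq, Fin.ext_iff] using h2
  refine (orientedMEternalNumber_le (D := ⟨fun x y => R (e x) (e y)⟩) hG (fun x y => hR _ _) hmem).trans ?_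
  exact (Set.ncard_insert_le _ _).trans (by simp)

/-- Two guards suffice on a complete graph minus at most one edge with at least four vertices. -/
theorem orientedMEternalNumber_le_two [Finite V] (hn : 4 ≤ Nat.card V) {p q : V} (hpq : p ≠ q)
    (hG : ∀ x y, x ≠ y → ¬ (x = p ∧ y = q) → ¬ (x = q ∧ y = p) → G.Adj x y) :
    orientedMEternalNumber G ≤ 2 := by
  rcases Nat.even_or_odd' (Nat.card V) with ⟨m, hm | hm⟩
  · obtain ⟨e, hp, hq⟩ := exists_equiv_fin hm hpq ⟨0, by omega⟩ ⟨m, by omega⟩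
      (by simp; omega)
    have hp' := congrArg Fin.val hp
    have hq' := congrArg Fin.val hq
    -- In cyclic order each `i` dominates the next `m - 1` vertices, and the guards occupy antipodal
    -- pairs. Antipodal edges are not used, so the missing edge may be `{0, m}`.
    refine orientedMEternalNumber_le_two_of_strategy e
      (R := fun i j => (i < j ∧ j < i + m) ∨ (j + m < i)) (Q := fun i j => j = i + m)
      (fun i j => by omega) (fun x y h => hG x y ?_ ?_ ?_) (fun i j => by omega) ?_
      (i := 0) (j := m) (by omega) (by omega) (by omega)
    · rintro rfl; omega
    · rintro ⟨rfl, rfl⟩; simp only at hp' hq'; omega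
    · rintro ⟨rfl, rfl⟩; simp only at hp' hq'; omega
    · intro i j r hi hj hr hij hri hrj
      by_cases h : r < m
      · exact ⟨r + m, by omega, by omega, by omega⟩
      · exact ⟨r - m, by omega, by omega, by omega⟩
  · obtain ⟨e, hp, hq⟩ := exists_equiv_fin hm hpq ⟨0, by omega⟩ ⟨m, by omega⟩
      (by simp; omega)
    have hp' := congrArg Fin.val hp
    have hq' := congrArg Fin.val hq
    -- Each `i` dominates the next `m` vertices of the cyclic order, except that `0 → m` is missing,
    -- and the guards occupy `i` and `i + m`. The pair `{m + 1, 0}` is excluded, because it leaves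
    -- `m` undefended; an attack on `m + 1` therefore leads to `{1, m + 1}`.
    refine orientedMEternalNumber_le_two_of_strategy e
      (R := fun i j => ((i < j ∧ j ≤ i + m) ∨ (j + m < i)) ∧ ¬ (i = 0 ∧ j = m))
      (Q := fun i j => (j = i + m ∨ i = j + m + 1) ∧ i ≠ m + 1)
      (fun i j => by omega) (fun x y h => hG x y ?_ ?_ ?_) (fun i j => by omega) ?_
      (i := 0) (j := m) (by omega) (by omega) (by omega)
    · rintro rfl; omega
    · rintro ⟨rfl, rfl⟩; simp only at hp' hq'; omega
    · rintro ⟨rfl, rfl⟩; simp only at hp' hq'; omega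
    · intro i j r hi hj hr hij hri hrj
      by_cases h1 : r = m + 1
      · exact ⟨1, by omega, by omega, by omega⟩
      by_cases h : r ≤ m
      · exact ⟨r + m, by omega, by omega, by omega⟩
      · exact ⟨r - m - 1, by omega, by omega, by omega⟩

end TwoGuards

/-! ### Trivially perfect graphs as cones over the components of `G - u`. -/

section Structure

variable {V ι : Type*} {G : SimpleGraph V} {u : V} {c : V → ι} {i j : ι}

theorem IsTriviallyPerfect.exists_isUniversal (hG : IsTriviallyPerfect G) (hc : G.Connected) :
    ∃ u, G.IsUniversal u := by
  obtain ⟨u, hu⟩ := hG Set.univ ((SimpleGraph.induceUnivIso G).connected_iff.2 hc)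
  exact ⟨u, fun w h => hu (w := ⟨w, trivial⟩) fun h' => h (congrArg Subtype.val h')⟩

theorem connected_induce_image_iff (S : Set V) (T : Set S) :
    (G.induce ((↑) '' T)).Connected ↔ ((G.induce S).induce T).Connected := by
  refine (SimpleGraph.Iso.connected_iff (G := (G.induce S).induce T)
    (H := G.induce ((↑) '' T)) ⟨Equiv.Set.image _ T Subtype.val_injective, ?_⟩).symm
  rfl

theorem IsTriviallyPerfect.induce (hG : IsTriviallyPerfect G) (S : Set V) :
    IsTriviallyPerfect (G.induce S) := by
  intro T hT
  obtain ⟨⟨_, ⟨x, hx, rfl⟩⟩, h⟩ := hG _ ((connected_induce_image_iff S T).2 hT)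
  exact ⟨⟨x, hx⟩, fun y hy => h (w := ⟨y, y, y.2, rfl⟩) fun h' =>
    hy (Subtype.ext (Subtype.ext (Subtype.mk.inj h')))⟩

/-- A universal vertex of the subgraph induced by a 4-cycle yields a chord. -/
theorem IsTriviallyPerfect.adj_or_adj_of_cycle (hG : IsTriviallyPerfect G) {x y z w : V}
    (hxz : G.Adj x z) (hzy : G.Adj z y) (hyw : G.Adj y w) (hwx : G.Adj w x) (hxy : x ≠ y)
    (hzw : z ≠ w) : G.Adj x y ∨ G.Adj z w := by
  have hconn : (G.induce {x, y, z, w}).Connected := by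
    refine (SimpleGraph.connected_iff_exists_forall_reachable _).2 ⟨⟨x, by simp⟩, ?_⟩
    have h1 : (G.induce {x, y, z, w}).Adj ⟨x, by simp⟩ ⟨z, by simp⟩ := hxz
    have h2 : (G.induce {x, y, z, w}).Adj ⟨z, by simp⟩ ⟨y, by simp⟩ := hzy
    have h3 : (G.induce {x, y, z, w}).Adj ⟨x, by simp⟩ ⟨w, by simp⟩ := hwx.symm
    rintro ⟨_, rfl | rfl | rfl | rfl⟩
    exacts [.rfl, h1.reachable.trans h2.reachable, h1.reachable, h3.reachable]
  obtain ⟨⟨v, hv⟩, hu⟩ := hG _ hconn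
  have hu' : ∀ t (ht : t ∈ ({x, y, z, w} : Set V)), v ≠ t → G.Adj v t := fun t ht h =>
    hu (w := ⟨t, ht⟩) fun h' => h (congrArg Subtype.val h')
  rcases hv with rfl | rfl | rfl | rfl
  · exact Or.inl (hu' y (by simp) hxy)
  · exact Or.inl (hu' x (by simp) hxy.symm).symm
  · exact Or.inr (hu' w (by simp) hzw)
  · exact Or.inr (hu' z (by simp) hzw.symm).symm

/-- The vertex `u` is universal in `G`, and the color classes of `c` on the other vertices are
the vertex sets of the connected components of `G - u`. -/
structure IsConeGraph (G : SimpleGraph V) (u : V) (c : V → ι) : Prop where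
  isUniversal : G.IsUniversal u
  color : ∀ x y, G.Adj x y → x ≠ u → y ≠ u → c x = c y
  connected : ∀ i, (G.induce (part u c i)).Connected

theorem IsConeGraph.nonempty_part (hG : IsConeGraph G u c) (i : ι) : (part u c i).Nonempty :=
  Set.nonempty_coe_sort.1 (hG.connected i).nonempty

theorem IsConeGraph.isCone (hG : IsConeGraph G u c) {H : Digraph V} (hH : IsOrientation G H) :
    IsCone H u c where
  asymm x y h h' := hH.2 x y ⟨h, h'⟩
  star _ hx := (hH.1 _ _).1 (hG.isUniversal hx.symm)
  color x y h := hG.color x y ((hH.1 _ _).2 (Or.inl h))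
  surj := hG.nonempty_part

theorem exists_isConeGraph {V : Type*} [Finite V] {G : SimpleGraph V} {u : V}
    (hV : 2 ≤ Nat.card V) (hu : G.IsUniversal u) :
    ∃ (n : ℕ) (c : V → Fin n), IsConeGraph G u c := by
  classical
  have : Nontrivial V := Finite.one_lt_card_iff_nontrivial.1 hV
  obtain ⟨x₀, hx₀⟩ := exists_ne u
  let G' := G.induce {u}ᶜ
  let e := Finite.equivFin G'.ConnectedComponent
  -- The color of `u` is irrelevant, since `part` omits `u`; that of `x₀` is used.
  let c : V → Fin (Nat.card G'.ConnectedComponent) := fun x =>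
    e (G'.connectedComponentMk (if h : x ≠ u then ⟨x, h⟩ else ⟨x₀, hx₀⟩))
  have hc : ∀ x (h : x ≠ u), c x = e (G'.connectedComponentMk ⟨x, h⟩) := fun x h => by simp [c, h]
  refine ⟨_, c, hu, fun x y h hx hy => ?_, fun i => ?_⟩
  · rw [hc x hx, hc y hy]
    exact congrArg e (SimpleGraph.ConnectedComponent.connectedComponentMk_eq_of_adj h)
  · have : part u c i = (↑) '' (e.symm i).supp := by
      ext x
      constructor
      · rintro ⟨hx, rfl⟩
        exact ⟨⟨x, hx⟩, by simp [hc x hx], rfl⟩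
      · rintro ⟨⟨x, hx⟩, h, rfl⟩
        refine ⟨hx, ?_⟩
        rw [SimpleGraph.ConnectedComponent.mem_supp_iff] at h
        rw [hc x hx, h, Equiv.apply_symm_apply]
    rw [this, connected_induce_image_iff]
    exact (e.symm i).connected_toSimpleGraph

theorem eq_of_reachable {W α : Type*} {G : SimpleGraph W} {f : W → α}
    (hf : ∀ x y, G.Adj x y → f x = f y) {x y : W} (h : G.Reachable x y) : f x = f y := by
  obtain ⟨p⟩ := h
  induction p with
  | nil => rfl
  | cons hadj _ ih => exact (hf _ _ hadj).trans ih

/-! ### The 2-vertex-connected components -/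

/-- Without `u` the connected part remains; if `u` is kept, it is still universal. -/
theorem IsConeGraph.isVertexConnected_two (hG : IsConeGraph G u c) (i : ι) :
    IsVertexConnected 2 (G.induce (insert u (part u c i))) := by
  have huB : u ∈ insert u (part u c i) := Set.mem_insert _ _
  have huniv : (G.induce (insert u (part u c i))).IsUniversal ⟨u, huB⟩ := fun w hw =>
    hG.isUniversal fun h => hw (Subtype.ext h)
  refine ⟨.of_isUniversal huniv, fun S hS hS1 => ?_⟩
  by_cases huS : ⟨u, huB⟩ ∈ S
  · have hne : ∀ x ∈ S, (x : V) = u := fun x hx =>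
      congrArg Subtype.val ((Set.ncard_le_one hS).1 hS1 x hx _ huS)
    let φ : G.induce (part u c i) →g (G.induce (insert u (part u c i))).induce Sᶜ :=
      ⟨fun x => ⟨⟨x, Or.inr x.2⟩, fun h => x.2.1 (hne _ h)⟩, fun h => h⟩
    refine (hG.connected i).preconnected.map φ fun ⟨⟨x, hx⟩, hxS⟩ => ?_
    rcases hx with rfl | hx
    · exact absurd huS hxS
    · exact ⟨⟨x, hx⟩, rfl⟩
  · exact (SimpleGraph.Connected.of_isUniversal (v := ⟨⟨u, huB⟩, huS⟩) fun w hw =>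
      huniv fun h => hw (Subtype.ext h)).preconnected

/-- After removal of `u` the set stays connected, so its colors agree. -/
theorem IsConeGraph.exists_subset (hG : IsConeGraph G u c) [Nonempty ι] {B : Set V}
    (hB : IsVertexConnected 2 (G.induce B)) : ∃ i, B ⊆ insert u (part u c i) := by
  by_cases h : ∃ x ∈ B, x ≠ u
  · obtain ⟨x, hx, hxu⟩ := h
    refine ⟨c x, fun y hy => ?_⟩
    by_cases hyu : y = u
    · exact Or.inl hyu
    have hsub : {z : B | (z : V) = u}.Subsingleton := fun a ha b hb =>
      Subtype.ext (ha.trans (Eq.symm hb))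
    have hr := hB.2 {z : B | (z : V) = u} hsub.finite
      ((Set.ncard_le_one hsub.finite).2 fun a ha b hb => hsub ha hb) ⟨⟨x, hx⟩, hxu⟩ ⟨⟨y, hy⟩, hyu⟩
    exact Or.inr ⟨hyu, (eq_of_reachable (f := fun z => c z.1.1)
      (fun a b hab => hG.color _ _ hab a.2 b.2) hr).symm⟩
  · push Not at h
    exact ⟨Classical.arbitrary ι, fun x hx => Or.inl (h x hx)⟩

theorem IsConeGraph.eq_of_subset (hG : IsConeGraph G u c)
    (h : insert u (part u c i) ⊆ insert u (part u c j)) : i = j := by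
  obtain ⟨x, hx⟩ := hG.nonempty_part i
  exact hx.2.symm.trans ((h (Or.inr hx)).resolve_left hx.1).2

theorem IsConeGraph.twoVertexConnectedComponents_eq (hG : IsConeGraph G u c) [Nonempty ι] :
    twoVertexConnectedComponents G = Set.range fun i => insert u (part u c i) := by
  ext B
  constructor
  · intro hB
    replace hB : Maximal (fun B : Set V => IsVertexConnected 2 (G.induce B)) B := hB
    obtain ⟨i, hi⟩ := hG.exists_subset hB.prop
    exact ⟨i, (hB.eq_of_subset (hG.isVertexConnected_two i) hi).symm⟩
  · rintro ⟨i, rfl⟩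
    refine ⟨hG.isVertexConnected_two i, fun B hB hiB => ?_⟩
    obtain ⟨j, hj⟩ := hG.exists_subset hB
    have hij : i = j := hG.eq_of_subset (Set.Subset.trans hiB hj)
    rwa [hij]

theorem IsConeGraph.injective (hG : IsConeGraph G u c) :
    Function.Injective fun i => insert u (part u c i) :=
  fun _ _ h => hG.eq_of_subset (Set.Subset.antisymm_iff.1 h).1

theorem IsConeGraph.ncard_twoVertexConnectedComponents (hG : IsConeGraph G u c) [Nonempty ι]
    [Fintype ι] : (twoVertexConnectedComponents G).ncard = Fintype.card ι := by
  rw [hG.twoVertexConnectedComponents_eq, ← Set.image_univ,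
    Set.ncard_image_of_injective _ hG.injective, Set.ncard_univ, Nat.card_eq_fintype_card]

theorem ncard_insert_part [Finite V] (u : V) (c : V → ι) (i : ι) :
    (insert u (part u c i)).ncard = (part u c i).ncard + 1 :=
  Set.ncard_insert_of_notMem fun h => h.1 rfl

/-! ### The values of the oriented m-eternal domination number -/

theorem IsConeGraph.exists_tops (hG : IsConeGraph G u c) (hTP : IsTriviallyPerfect G) :
    ∃ v : ι → V, (∀ i, v i ∈ part u c i) ∧ ∀ i, ∀ x ∈ part u c i, x ≠ v i → G.Adj x (v i) := by
  choose v hv using fun i => hTP _ (hG.connected i)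
  exact ⟨fun i => v i, fun i => (v i).2, fun i x hx hne =>
    (hv i (w := ⟨x, hx⟩) fun h => hne (congrArg Subtype.val h.symm)).symm⟩

variable [Finite V]

theorem IsConeGraph.orientedMEternalNumber_eq_card_add_one [Fintype ι] (hG : IsConeGraph G u c)
    (hTP : IsTriviallyPerfect G) (h : ∀ i, (part u c i).ncard ≤ 2) :
    orientedMEternalNumber G = Fintype.card ι + 1 := by
  obtain ⟨v, hv, hadj⟩ := hG.exists_tops hTP
  exact le_antisymm (orientedMEternalNumber_le_card_add_one hv hadj hG.isUniversal h)
    (le_orientedMEternalNumber fun H hH S hS => (hG.isCone hH).card_add_one_le hS)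

theorem IsConeGraph.orientedMEternalNumber_eq_card_add_two [Fintype ι] (hG : IsConeGraph G u c)
    (hTP : IsTriviallyPerfect G) (hij : i ≠ j) (hi : 3 ≤ (part u c i).ncard)
    (hj : 2 ≤ (part u c j).ncard) : orientedMEternalNumber G = Fintype.card ι + 2 := by
  obtain ⟨v, hv, hadj⟩ := hG.exists_tops hTP
  obtain ⟨w, hw, hwv⟩ := (Set.one_lt_ncard_iff_nontrivial.1
    (show 1 < (part u c i).ncard by omega)).exists_ne (v i)
  refine le_antisymm (orientedMEternalNumber_le_card_add_two hv hadj hG.isUniversal hw.1 ?_)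
    (le_orientedMEternalNumber fun H hH S hS => (hG.isCone hH).card_add_two_le hij hi hj hS)
  rintro ⟨k, rfl⟩
  exact hwv (by rw [(hv k).2.symm.trans hw.2])

/-- The other parts are leaves at `u`: permanent guards on them give one inequality,
`orientedMEternalNumber_induce_compl_add_le` the other. -/
theorem IsConeGraph.orientedMEternalNumber_eq_induce_add [Fintype ι] (hG : IsConeGraph G u c)
    (h : ∀ j, j ≠ i → (part u c j).ncard = 1) :
    orientedMEternalNumber G =
      orientedMEternalNumber (G.induce (insert u (part u c i))) + (Fintype.card ι - 1) := by
  classical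
  have hcard : (insert u (part u c i))ᶜ.ncard = Fintype.card ι - 1 := by
    have h1 := ncard_eq_sum_part u c (insert u (part u c i))ᶜ
    have h2 : (insert u (part u c i))ᶜ ∩ {u} = ∅ := by ext; simp +contextual
    have h3 : ∀ j, ((insert u (part u c i))ᶜ ∩ part u c j).ncard = if j = i then 0 else 1 := by
      intro j
      split_ifs with hj
      · subst hj
        rw [Set.ncard_eq_zero]
        ext x
        simp +contextual
      · rw [← h j hj]
        congr 1
        refine Set.inter_eq_right.2 fun x hx hx' => ?_
        rcases hx' with rfl | hx'
        · exact hx.1 rfl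
        · exact hj (hx.2.symm.trans hx'.2)
    rw [h1, h2, Set.ncard_empty, Finset.sum_congr rfl fun j _ => h3 j]
    simp [Finset.sum_ite, Finset.filter_ne', Finset.card_erase_of_mem]
  rw [← hcard]
  refine le_antisymm (orientedMEternalNumber_le_induce_add _) ?_
  have := orientedMEternalNumber_induce_compl_add_le (G := G) (u := u)
    (W := (insert u (part u c i))ᶜ) (by simp) fun w hw x hxw => ?_
  · rwa [compl_compl] at this
  · simp only [Set.mem_compl_iff, Set.mem_insert_iff, not_or] at hw
    by_contra hxu
    have hcx := hG.color x w hxw hxu hw.1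
    have hj : c w ≠ i := fun hc => hw.2 ⟨hw.1, hc⟩
    exact hxw.ne ((Set.ncard_le_one (Set.toFinite _)).1 (h _ hj).le x ⟨hxu, hcx⟩ w ⟨hw.1, rfl⟩)

/-- A trivially perfect graph with two universal vertices has value at most `3`, and the value is
`3` if and only if three vertices are not universal. -/
theorem orientedMEternalNumber_of_two_universal (hTP : IsTriviallyPerfect G) {u v : V}
    (hu : G.IsUniversal u) (hv : G.IsUniversal v) (huv : u ≠ v) (hV : 3 ≤ Nat.card V) :
    orientedMEternalNumber G ≤ 3 ∧
      orientedMEternalNumber G = if 3 ≤ {x | ¬ G.IsUniversal x}.ncard then 3 else 2 := by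
  -- The graph is treated as a cone with the single part `V \ {u}`, whose universal vertex is `v`.
  have hvu : ∀ i : Unit, (fun _ => v) i ∈ part u (fun _ => ()) i := fun _ => ⟨huv.symm, rfl⟩
  have hadj : ∀ i : Unit, ∀ x ∈ part u (fun _ => ()) i, x ≠ v → G.Adj x v :=
    fun _ x _ hx => (hv hx.symm).symm
  have h3 : orientedMEternalNumber G ≤ 3 := by
    obtain ⟨w, hw⟩ : ∃ w, w ∉ ({u, v} : Set V) := by
      by_contra! h
      have h1 := Set.ncard_le_ncard (fun x (_ : x ∈ Set.univ) => h x)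
      have h2 := Set.ncard_insert_le u {v}
      rw [Set.ncard_singleton] at h2
      rw [Set.ncard_univ] at h1
      omega
    simp only [Set.mem_insert_iff, Set.mem_singleton_iff, not_or] at hw
    exact orientedMEternalNumber_le_card_add_two hvu hadj hu hw.1 (by
      rintro ⟨_, h⟩
      exact hw.2 h.symm)
  refine ⟨h3, ?_⟩
  split_ifs with hN
  · refine le_antisymm h3 (le_orientedMEternalNumber fun H hH S hS => ?_)
    have key : ∀ d a b, a ≠ b → a ≠ d → b ≠ d → ¬ G.Adj d a → ¬ G.Adj d b → 3 ≤ S.ncard := by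
      intro d a b hab ha hb hda hdb
      have hnot : ∀ x y, ¬ G.Adj x y → ¬ H.Adj x y := fun x y h h' => h ((hH.1 _ _).2 (Or.inl h'))
      exact three_le_ncard_of_not_adj (fun x y h h' => hH.2 x y ⟨h, h'⟩) hab ha hb (hnot _ _ hda)
        (hnot _ _ fun h => hda h.symm) (hnot _ _ hdb) (hnot _ _ fun h => hdb h.symm) hS
    obtain ⟨x, hx⟩ := (Set.ncard_pos (Set.toFinite _)).1
      (show 0 < {x | ¬ G.IsUniversal x}.ncard by omega)
    simp only [Set.mem_ofPred_eq, SimpleGraph.IsUniversal, not_forall] at hx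
    obtain ⟨y, hxy, hnxy⟩ := hx
    obtain ⟨z, hz, hz'⟩ : ∃ z, ¬ G.IsUniversal z ∧ z ∉ ({x, y} : Set V) := by
      by_contra! h
      have h1 : {x | ¬ G.IsUniversal x}.ncard ≤ ({x, y} : Set V).ncard := Set.ncard_le_ncard h
      have h2 := Set.ncard_insert_le x {y}
      rw [Set.ncard_singleton] at h2
      omega
    simp only [Set.mem_insert_iff, Set.mem_singleton_iff, not_or] at hz'
    obtain ⟨hzx, hzy⟩ := hz'
    simp only [SimpleGraph.IsUniversal, not_forall] at hz
    obtain ⟨w, hzw, hnzw⟩ := hz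
    -- Unless some vertex has two non-neighbors, the non-edges `xy` and `zw` are disjoint and `x z y
    -- w` is an induced 4-cycle.
    by_cases hxz : G.Adj x z
    · by_cases hyz : G.Adj y z
      · have hwx : w ≠ x := by rintro rfl; exact hnzw hxz.symm
        have hwy : w ≠ y := by rintro rfl; exact hnzw hyz.symm
        by_cases hxw : G.Adj x w
        · by_cases hyw : G.Adj y w
          · exact absurd (hTP.adj_or_adj_of_cycle hxz hyz.symm hyw hxw.symm hxy hzw)
              (by tauto)
          · exact key y x w hwx.symm hxy hwy (fun h => hnxy h.symm) hyw
        · exact key x y w hwy.symm hxy.symm hwx hnxy hxw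
      · exact key y x z (Ne.symm hzx) hxy hzy (fun h => hnxy h.symm) hyz
    · exact key x y z (Ne.symm hzy) hxy.symm hzx hnxy hxz
  · refine le_antisymm ?_ (le_orientedMEternalNumber fun H hH S hS => ?_)
    -- The rotation needs four vertices; for three, the single part has two vertices and the
    -- triangle strategy applies.
    · rcases hV.eq_or_lt with hV | hV
      · refine orientedMEternalNumber_le_card_add_one hvu hadj hu fun i => ?_
        have h1 := Set.ncard_le_ncard (Set.subset_univ (insert u (part u (fun _ => ()) i)))
        rw [ncard_insert_part, Set.ncard_univ] at h1
        omega
      · by_cases hall : ∀ x, G.IsUniversal x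
        · exact orientedMEternalNumber_le_two hV huv fun x y hxy _ _ => hall x hxy
        · simp only [SimpleGraph.IsUniversal, not_forall] at hall
          obtain ⟨p, q, hpq, hnpq⟩ := hall
          have hp : p ∈ {x | ¬ G.IsUniversal x} := fun h => hnpq (h hpq)
          have hq : q ∈ {x | ¬ G.IsUniversal x} := fun h => hnpq (h hpq.symm).symm
          have hsub : ∀ x, ¬ G.IsUniversal x → x = p ∨ x = q := by
            intro x hx
            by_contra! hne
            have h1 : ({x, p, q} : Set V) ⊆ {x | ¬ G.IsUniversal x} := by
              rintro y (rfl | rfl | rfl) <;> assumption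
            have h2 := Set.ncard_le_ncard h1
            rw [Set.ncard_eq_three.2 ⟨x, p, q, hne.1, hne.2, hpq, rfl⟩] at h2
            exact hN h2
          refine orientedMEternalNumber_le_two hV hpq fun x y hxy h1 h2 => ?_
          by_contra hnadj
          have hx := hsub x fun h => hnadj (h hxy)
          have hy := hsub y fun h => hnadj (h hxy.symm).symm
          rcases hx with rfl | rfl <;> rcases hy with rfl | rfl <;> simp_all
    · have : IsCone H u fun _ => () :=
        { asymm := fun x y h h' => hH.2 x y ⟨h, h'⟩
          star := fun x hx => (hH.1 _ _).1 (hu hx.symm)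
          color := fun _ _ _ _ _ => rfl
          surj := fun _ => ⟨v, huv.symm, rfl⟩ }
      exact this.card_add_one_le hS

/-- The value on a block of at least three vertices. -/
theorem IsConeGraph.orientedMEternalNumber_block (hG : IsConeGraph G u c)
    (hTP : IsTriviallyPerfect G) (hi : 2 ≤ (part u c i).ncard) :
    orientedMEternalNumber (G.induce (insert u (part u c i))) ≤ 3 ∧
      orientedMEternalNumber (G.induce (insert u (part u c i))) =
        if 3 ≤ {x | ¬ (G.induce (insert u (part u c i))).IsUniversal x}.ncard then 3 else 2 := by
  obtain ⟨v, hv, hadj⟩ := hG.exists_tops hTP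
  refine orientedMEternalNumber_of_two_universal (hTP.induce _) (u := ⟨u, Or.inl rfl⟩)
    (v := ⟨v i, Or.inr (hv i)⟩) (fun w hw => hG.isUniversal fun h => hw (Subtype.ext h))
    (fun w hw => ?_) (fun h => (hv i).1 (congrArg Subtype.val h).symm) ?_
  · obtain ⟨w, rfl | hw'⟩ := w
    · exact (hG.isUniversal (hv i).1.symm).symm
    · exact (hadj i w hw' fun h => hw (Subtype.ext h.symm)).symm
  · rw [Nat.card_coe_set_eq, ncard_insert_part]
    omega

end Structure

/-! ### The three cases for connected graphs. -/

section Values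

variable {V ι : Type*} {G : SimpleGraph V} {u : V} {c : V → ι} {i j : ι}

theorem orientedMEternalNumber_of_connected [Finite V] (hV : 2 ≤ Nat.card V) (hc : G.Connected)
    (hTP : IsTriviallyPerfect G) (l : ℕ) (hl : (twoVertexConnectedComponents G).ncard = l) :
    (∀ B ∈ twoVertexConnectedComponents G, 3 ≤ B.ncard →
      (∀ B' ∈ twoVertexConnectedComponents G, 3 ≤ B'.ncard → B' = B) →
      orientedMEternalNumber G = orientedMEternalNumber (G.induce B) + (l - 1) ∧
        orientedMEternalNumber (G.induce B) ≤ 3) ∧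
    ((∀ B ∈ twoVertexConnectedComponents G, B.ncard ≤ 3) → orientedMEternalNumber G = l + 1) ∧
    ((∃ B ∈ twoVertexConnectedComponents G, ∃ B' ∈ twoVertexConnectedComponents G,
      B ≠ B' ∧ 4 ≤ B.ncard ∧ 3 ≤ B'.ncard) → orientedMEternalNumber G = l + 2) := by
  obtain ⟨u, hu⟩ := hTP.exists_isUniversal hc
  obtain ⟨n, c, hG⟩ := exists_isConeGraph hV hu
  have : Nontrivial V := Finite.one_lt_card_iff_nontrivial.1 hV
  have : Nonempty (Fin n) := ⟨c u⟩
  rw [hG.ncard_twoVertexConnectedComponents] at hl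
  subst hl
  rw [hG.twoVertexConnectedComponents_eq]
  refine ⟨?_, fun h => ?_, ?_⟩
  · rintro _ ⟨i, rfl⟩ hi h
    rw [ncard_insert_part] at hi
    refine ⟨hG.orientedMEternalNumber_eq_induce_add fun j hj => ?_,
      (hG.orientedMEternalNumber_block hTP (by omega)).1⟩
    have h1 := (Set.ncard_pos (Set.toFinite _)).2 (hG.nonempty_part j)
    by_contra h2
    refine hj (hG.injective (h _ ⟨j, rfl⟩ ?_))
    rw [ncard_insert_part]
    omega
  · refine hG.orientedMEternalNumber_eq_card_add_one hTP fun i => ?_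
    have := h _ ⟨i, rfl⟩
    rw [ncard_insert_part] at this
    omega
  · rintro ⟨_, ⟨i, rfl⟩, _, ⟨j, rfl⟩, hij, hi, hj⟩
    rw [ncard_insert_part] at hi hj
    exact hG.orientedMEternalNumber_eq_card_add_two hTP (i := i) (j := j)
      (by rintro rfl; exact hij rfl) (by omega) (by omega)

end Values

/-! ### A formula in terms of degrees -/

section Formula

/-- The degree of a vertex. -/
noncomputable def deg {V : Type*} (G : SimpleGraph V) (x : V) : ℕ := (G.neighborSet x).ncard

/-- The vertex `w` precedes `x` in the order by decreasing degree. -/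
def Above {V : Type*} [LT V] (G : SimpleGraph V) (w x : V) : Prop :=
  deg G x < deg G w ∨ deg G x = deg G w ∧ w < x

/-- The number of neighbors that precede `x` in the order by decreasing degree. -/
noncomputable def upCount {V : Type*} [LT V] (G : SimpleGraph V) (x : V) : ℕ :=
  {w | G.Adj x w ∧ Above G w x}.ncard

/-- The number of neighbors of degree at least `k`. -/
noncomputable def bigCount {V : Type*} (G : SimpleGraph V) (k : ℕ) (x : V) : ℕ :=
  {w | G.Adj x w ∧ k ≤ deg G w}.ncard

/-- The criterion for one additional guard at the root `x` of a component. -/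
def NeedsGuard {V : Type*} (G : SimpleGraph V) (x : V) : Prop :=
  1 ≤ bigCount G 3 x ∧ 3 ≤ {w | G.Adj x w ∧ 2 ≤ deg G w ∧ deg G w ≠ bigCount G 2 x}.ncard

/-- The number of guards computed from degrees. -/
noncomputable def guardCount {V : Type*} [LT V] (G : SimpleGraph V) : ℕ :=
  {x | upCount G x ≤ 1}.ncard + {x | upCount G x = 0 ∧ NeedsGuard G x}.ncard

variable {V ι : Type*} {G : SimpleGraph V} {u : V} {c : V → ι} {i j : ι}

section Local

/-- All quantities in `guardCount` are counts of neighbors, hence unchanged on a union `B` of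
components. -/
theorem ncard_adj_induce {B : Set V} (hB : ∀ x y, G.Adj x y → x ∈ B → y ∈ B) (x : B)
    {P : V → Prop} {P' : B → Prop} (hP : ∀ w : B, P w ↔ P' w) :
    {w | G.Adj x w ∧ P w}.ncard = {w | (G.induce B).Adj x w ∧ P' w}.ncard := by
  rw [← Set.ncard_image_of_injective _ Subtype.val_injective]
  congr 1
  ext w
  constructor
  · rintro ⟨h, hw⟩
    exact ⟨⟨w, hB _ _ h x.2⟩, ⟨h, (hP ⟨w, _⟩).1 hw⟩, rfl⟩
  · rintro ⟨w, ⟨h, hw⟩, rfl⟩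
    exact ⟨h, (hP w).2 hw⟩

variable {B : Set V}

theorem deg_induce (hB : ∀ x y, G.Adj x y → x ∈ B → y ∈ B) (x : B) : deg G x = deg (G.induce B) x := by
  have := ncard_adj_induce hB x (P := fun _ => True) (P' := fun _ => True) (fun _ => Iff.rfl)
  simp only [and_true] at this
  exact this

theorem bigCount_induce (hB : ∀ x y, G.Adj x y → x ∈ B → y ∈ B) (x : B) (k : ℕ) : bigCount G k x = bigCount (G.induce B) k x :=
  ncard_adj_induce hB x fun w => by rw [deg_induce hB]

theorem upCount_induce [LT V] (hB : ∀ x y, G.Adj x y → x ∈ B → y ∈ B) (x : B) : upCount G x = upCount (G.induce B) x :=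
  ncard_adj_induce hB x fun w => by
    unfold Above
    rw [deg_induce hB, deg_induce hB]
    rfl

theorem needsGuard_induce (hB : ∀ x y, G.Adj x y → x ∈ B → y ∈ B) (x : B) : NeedsGuard G x ↔ NeedsGuard (G.induce B) x := by
  unfold NeedsGuard
  rw [bigCount_induce hB, bigCount_induce hB, ncard_adj_induce hB x fun w => ?_]
  rw [deg_induce hB]

end Local

theorem guardCount_eq_sum [LT V] [Finite V] [Fintype ι] (c : V → ι)
    (hc : ∀ x y, G.Adj x y → c x = c y) :
    guardCount G = ∑ i, guardCount (G.induce {x | c x = i}) := by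
  unfold guardCount
  rw [Finset.sum_add_distrib, ncard_eq_sum_fibers c, ncard_eq_sum_fibers c {x | _ ∧ _}]
  have hB : ∀ i x y, G.Adj x y → x ∈ {x | c x = i} → y ∈ {x | c x = i} :=
    fun i x y h hx => (hc x y h).symm.trans hx
  congr 1
  · refine Finset.sum_congr rfl fun i _ => ?_
    rw [← ncard_preimage_val]
    congr 1
    ext x
    simp only [Set.mem_preimage, Set.mem_ofPred_eq, upCount_induce (hB i)]
  · refine Finset.sum_congr rfl fun i _ => ?_
    rw [← ncard_preimage_val]
    congr 1
    ext x
    simp only [Set.mem_preimage, Set.mem_ofPred_eq, upCount_induce (hB i),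
      needsGuard_induce (hB i)]

end Formula

/-! ### Recognizing the universal vertex, the parts and the additional guard from degrees. -/

section Formula

variable {V ι : Type*} {G : SimpleGraph V} {u : V} {c : V → ι} {i j : ι} {x : V}

namespace IsConeGraph

theorem neighborSet_subset (hG : IsConeGraph G u c) (hx : x ∈ part u c i) :
    G.neighborSet x ⊆ insert u (part u c i \ {x}) := by
  intro w hw
  have hw' : G.Adj x w := hw
  by_cases hwu : w = u
  · exact Or.inl hwu
  · exact Or.inr ⟨⟨hwu, (hG.color x w hw' hx.1 hwu).symm.trans hx.2⟩, hw'.ne'⟩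

variable [Finite V]

theorem ncard_insert_part_diff (hx : x ∈ part u c i) :
    (insert u (part u c i \ {x})).ncard = (part u c i).ncard := by
  rw [Set.ncard_insert_of_notMem fun h => h.1.1 rfl, Set.ncard_sdiff_singleton_add_one hx]

theorem deg_le (hG : IsConeGraph G u c) (hx : x ∈ part u c i) : deg G x ≤ (part u c i).ncard :=
  (Set.ncard_le_ncard (hG.neighborSet_subset hx)).trans (ncard_insert_part_diff hx).le

/-- The neighbors of `x` lie in the part with `x` replaced by `u`, a set as large as the part; full
degree means that all of it is attained. -/
theorem deg_eq_iff (hG : IsConeGraph G u c) (hx : x ∈ part u c i) :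
    deg G x = (part u c i).ncard ↔ ∀ y ∈ part u c i, y ≠ x → G.Adj x y := by
  constructor
  · intro h y hy hyx
    have := Set.eq_of_subset_of_ncard_le (hG.neighborSet_subset hx)
      ((ncard_insert_part_diff hx).trans h.symm).le
    have hmem : y ∈ G.neighborSet x := by
      rw [this]
      exact Or.inr ⟨hy, hyx⟩
    exact hmem
  · intro h
    rw [← ncard_insert_part_diff hx]
    refine congrArg Set.ncard (Set.Subset.antisymm (hG.neighborSet_subset hx) ?_)
    rintro y (rfl | hy)
    · exact (hG.isUniversal hx.1.symm).symm
    · exact h y hy.1 hy.2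

theorem two_le_deg (hG : IsConeGraph G u c) (hTP : IsTriviallyPerfect G) (hx : x ∈ part u c i)
    (hi : 2 ≤ (part u c i).ncard) : 2 ≤ deg G x := by
  obtain ⟨v, hv, hadj⟩ := hG.exists_tops hTP
  obtain ⟨y, hy, hxy⟩ : ∃ y ∈ part u c i, G.Adj x y := by
    by_cases h : x = v i
    · obtain ⟨y, hy, hne⟩ := (Set.one_lt_ncard_iff_nontrivial.1 hi).exists_ne x
      exact ⟨y, hy, h ▸ (hadj i y hy (h ▸ hne)).symm⟩
    · exact ⟨v i, hv i, hadj i x hx h⟩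
  have hsub : {u, y} ⊆ G.neighborSet x := by
    rintro z (rfl | rfl)
    · exact (hG.isUniversal hx.1.symm).symm
    · exact hxy
  have := Set.ncard_le_ncard hsub
  rwa [Set.ncard_pair hy.1.symm] at this

/-- Degrees thus reveal which vertices lie in parts of at least two vertices. -/
theorem adj_and_two_le_deg_iff (hG : IsConeGraph G u c) (hTP : IsTriviallyPerfect G) (x : V) :
    (G.Adj u x ∧ 2 ≤ deg G x) ↔ x ≠ u ∧ 2 ≤ (part u c (c x)).ncard := by
  constructor
  · rintro ⟨h, h2⟩
    exact ⟨h.ne', h2.trans (hG.deg_le ⟨h.ne', rfl⟩)⟩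
  · rintro ⟨h, h2⟩
    exact ⟨hG.isUniversal h.symm, hG.two_le_deg hTP ⟨h, rfl⟩ h2⟩

theorem bigCount_two_eq (hG : IsConeGraph G u c) (hTP : IsTriviallyPerfect G) :
    bigCount G 2 u = {x | x ≠ u ∧ 2 ≤ (part u c (c x)).ncard}.ncard := by
  unfold bigCount
  congr 1
  ext x
  exact hG.adj_and_two_le_deg_iff hTP x

/-- `bigCount G 2 u` also counts the vertices of the part `j`, while the degree of `x` is at most
the size of its own part. -/
theorem deg_lt_bigCount (hG : IsConeGraph G u c) (hTP : IsTriviallyPerfect G) (hx : x ∈ part u c i)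
    (hi : 2 ≤ (part u c i).ncard) (hij : i ≠ j) (hj : 2 ≤ (part u c j).ncard) :
    deg G x < bigCount G 2 u := by
  refine (hG.deg_le hx).trans_lt ?_
  rw [hG.bigCount_two_eq hTP]
  obtain ⟨y, hy⟩ := hG.nonempty_part j
  refine Set.ncard_lt_ncard ⟨?_, fun h => ?_⟩
  · rintro z ⟨hz, rfl⟩
    exact ⟨hz, hi⟩
  · exact hij ((h ⟨hy.1, by rwa [hy.2]⟩).2.symm.trans hy.2)

/-- The first half of `NeedsGuard` says that some part has three vertices. If another part has two,
no degree equals `bigCount G 2 u`, and the second half holds. If all others are leaves, `bigCount G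
2 u` is the size of the large part, and the second half counts the non-universal vertices of its
block. -/
theorem orientedMEternalNumber_eq_needsGuard [Fintype ι] [Nonempty ι] (hG : IsConeGraph G u c)
    (hTP : IsTriviallyPerfect G) :
    (NeedsGuard G u ∧ orientedMEternalNumber G = Fintype.card ι + 2) ∨
      (¬ NeedsGuard G u ∧ orientedMEternalNumber G = Fintype.card ι + 1) := by
  obtain ⟨v, hv, hadj⟩ := hG.exists_tops hTP
  by_cases h3 : ∀ i, (part u c i).ncard ≤ 2
  · refine Or.inr ⟨fun h => ?_, hG.orientedMEternalNumber_eq_card_add_one hTP h3⟩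
    obtain ⟨w, hw, hw3⟩ := (Set.ncard_pos (Set.toFinite _)).1 h.1
    have h1 := hG.deg_le ⟨hw.ne', rfl⟩
    have h2 := h3 (c w)
    omega
  push Not at h3
  obtain ⟨i, hi⟩ := h3
  have hbig : 1 ≤ bigCount G 3 u := by
    refine (Set.ncard_pos (Set.toFinite _)).2 ⟨v i, hG.isUniversal (hv i).1.symm, ?_⟩
    rw [(hG.deg_eq_iff (hv i)).2 fun y hy hne => (hadj i y hy hne).symm]
    omega
  by_cases hj : ∃ j, j ≠ i ∧ 2 ≤ (part u c j).ncard
  · obtain ⟨j, hji, hj⟩ := hj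
    refine Or.inl ⟨⟨hbig, ?_⟩, hG.orientedMEternalNumber_eq_card_add_two hTP hji.symm hi hj⟩
    refine le_trans ?_ (Set.ncard_le_ncard (s := part u c i) fun x hx => ?_)
    · omega
    · obtain ⟨h1, h2⟩ := (hG.adj_and_two_le_deg_iff hTP x).2 ⟨hx.1, by rw [hx.2]; omega⟩
      exact ⟨h1, h2, (hG.deg_lt_bigCount hTP hx (by omega) hji.symm hj).ne⟩
  · push Not at hj
    have hone : ∀ j, j ≠ i → (part u c j).ncard = 1 := fun j hji => by
      have h1 := (Set.ncard_pos (Set.toFinite _)).2 (hG.nonempty_part j)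
      have h2 := hj j hji
      omega
    have hmem : ∀ x, (G.Adj u x ∧ 2 ≤ deg G x) ↔ x ∈ part u c i := fun x => by
      rw [hG.adj_and_two_le_deg_iff hTP]
      refine and_congr_right fun _ => ⟨fun h => ?_, fun h => by rw [h]; omega⟩
      by_contra hne
      have := hone _ hne
      omega
    have hM : bigCount G 2 u = (part u c i).ncard := congrArg Set.ncard (Set.ext hmem)
    have hcnt : {w | G.Adj u w ∧ 2 ≤ deg G w ∧ deg G w ≠ bigCount G 2 u}.ncard =
        {x | ¬ (G.induce (insert u (part u c i))).IsUniversal x}.ncard := by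
      rw [← Set.ncard_image_of_injective _ Subtype.val_injective]
      congr 1
      ext x
      simp only [Set.mem_ofPred_eq, ← and_assoc]
      rw [hmem, hM]
      constructor
      · rintro ⟨hx, hne⟩
        refine ⟨⟨x, Or.inr hx⟩, fun h => hne ((hG.deg_eq_iff hx).2 fun y hy hyx => ?_), rfl⟩
        exact h (w := ⟨y, Or.inr hy⟩) fun h' => hyx (congrArg Subtype.val h').symm
      · rintro ⟨⟨x, rfl | hx⟩, hnu, rfl⟩
        · exact absurd (fun w hw => hG.isUniversal fun h => hw (Subtype.ext h)) hnu
        · refine ⟨hx, fun h => hnu ?_⟩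
          rintro ⟨w, rfl | hw⟩ hne
          · exact (hG.isUniversal hx.1.symm).symm
          · exact (hG.deg_eq_iff hx).1 h w hw fun h' => hne (Subtype.ext h'.symm)
    have hγ := hG.orientedMEternalNumber_eq_induce_add hone
    rw [(hG.orientedMEternalNumber_block hTP (by omega)).2, ← hcnt] at hγ
    have hι := Fintype.card_pos (α := ι)
    split_ifs at hγ with hN
    · exact Or.inl ⟨⟨hbig, hN⟩, by omega⟩
    · exact Or.inr ⟨fun h => hN h.2, by omega⟩

end IsConeGraph

theorem exists_forall_above [LinearOrder V] [Finite V] {S : Set V} (hS : S.Nonempty) :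
    ∃ v ∈ S, ∀ x ∈ S, x ≠ v → Above G v x := by
  obtain ⟨v, hv, hmax⟩ := (Set.toFinite S).exists_maximalFor
    -- The dual order makes ties be won by the smaller vertex, as in `Above`.
    (fun x => toLex (deg G x, OrderDual.toDual x)) _ hS
  refine ⟨v, hv, fun x hx hne => ?_⟩
  have h : ¬ toLex (deg G v, OrderDual.toDual v) ≤ toLex (deg G x, OrderDual.toDual x) :=
    fun h => hne (by simpa using congrArg (fun p => (ofLex p).2) (le_antisymm (hmax hx h) h))
  rw [not_le, Prod.Lex.toLex_lt_toLex] at h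
  exact h

theorem Above.deg_le [LT V] {w x : V} (h : Above G w x) : deg G x ≤ deg G w :=
  h.elim le_of_lt fun h => h.1.le

theorem Above.asymm [LinearOrder V] {w x : V} (h : Above G w x) : ¬ Above G x w := by
  rintro h'
  rcases h with h | ⟨h, h1⟩ <;> rcases h' with h' | ⟨h', h2⟩
  · omega
  · omega
  · omega
  · exact lt_asymm h1 h2

theorem orientedMEternalNumber_of_card_eq_one [Finite V] (hV : Nat.card V = 1) :
    orientedMEternalNumber G = 1 := by
  obtain ⟨H, hH, S, hS, hSc⟩ := exists_isOrientation_mem_MEDS G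
  obtain ⟨h1, ⟨x⟩⟩ := Nat.card_eq_one_iff_unique.1 hV
  obtain ⟨T, hT, hxT, hST⟩ := exists_step_of_mem_MEDS hS x
  have h2 := (Set.ncard_pos (Set.toFinite T)).2 ⟨x, hxT⟩
  have h3 := Set.ncard_le_ncard (Set.subset_univ S)
  rw [Set.ncard_univ] at h3
  rw [hST.ncard_eq] at h2
  omega

/-- The topmost vertex `u` has maximal degree, so it is universal, and the topmost vertex `v i` of a
part is adjacent to the rest of the part. Every other vertex has both `u` and some `v i` above it,
so exactly `u` and the `v i` have `upCount` at most one. -/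
theorem orientedMEternalNumber_eq_guardCount_of_connected [LinearOrder V] [Finite V]
    (hc : G.Connected) (hTP : IsTriviallyPerfect G) :
    orientedMEternalNumber G = guardCount G := by
  have hne := hc.nonempty
  have hpos : 0 < Nat.card V := Nat.card_pos
  rcases (show 1 ≤ Nat.card V from hpos).eq_or_lt with hV | hV
  · rw [orientedMEternalNumber_of_card_eq_one hV.symm]
    obtain ⟨h1, ⟨x⟩⟩ := Nat.card_eq_one_iff_unique.1 hV.symm
    have hadj : ∀ x y, ¬ G.Adj x y := fun x y h => h.ne (Subsingleton.elim x y)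
    simp [guardCount, upCount, NeedsGuard, bigCount, hadj]
  obtain ⟨u, -, hu⟩ := exists_forall_above (G := G) (Set.univ_nonempty (α := V))
  have huniv : G.IsUniversal u := by
    obtain ⟨u₀, hu₀⟩ := hTP.exists_isUniversal hc
    rw [← SimpleGraph.neighborSet_eq_compl_singleton]
    refine Set.eq_of_subset_of_ncard_le (fun w hw => Ne.symm (G.ne_of_adj hw)) ?_
    have h1 : deg G u₀ = ({u₀}ᶜ : Set V).ncard := congrArg Set.ncard hu₀.neighborSet_eq
    have h2 : deg G u₀ ≤ deg G u := by
      by_cases h : u₀ = u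
      · rw [h]
      · exact (hu u₀ trivial h).deg_le
    have h3 := Set.ncard_add_ncard_compl {u}
    have h4 := Set.ncard_add_ncard_compl {u₀}
    rw [Set.ncard_singleton] at h3 h4
    unfold deg at h1 h2
    omega
  obtain ⟨n, c, hG⟩ := exists_isConeGraph hV huniv
  have : Nonempty (Fin n) := ⟨c u⟩
  choose v hv hvmax using fun i => exists_forall_above (G := G) (hG.nonempty_part i)
  have hadj : ∀ i, ∀ y ∈ part u c i, y ≠ v i → G.Adj (v i) y := by
    intro i
    refine (hG.deg_eq_iff (hv i)).1 (le_antisymm (hG.deg_le (hv i)) ?_)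
    obtain ⟨t, ht, htadj⟩ := hG.exists_tops hTP
    rw [← (hG.deg_eq_iff (ht i)).2 fun y hy hne => (htadj i y hy hne).symm]
    by_cases h : t i = v i
    · rw [h]
    · exact (hvmax i _ (ht i) h).deg_le
  have hup : ∀ x, upCount G x = 0 ↔ x = u := by
    intro x
    unfold upCount
    rw [Set.ncard_eq_zero]
    constructor
    · intro h
      by_contra hx
      have : u ∈ {w | G.Adj x w ∧ Above G w x} := ⟨(huniv (Ne.symm hx)).symm, hu x trivial hx⟩
      rw [h] at this
      exact this
    · rintro rfl
      exact Set.eq_empty_of_forall_notMem fun w hw => (hu w trivial hw.1.ne').asymm hw.2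
  have hup1 : {x | upCount G x ≤ 1} = insert u (Set.range v) := by
    ext x
    constructor
    · intro h
      by_cases hx : x = u
      · exact Or.inl hx
      refine Or.inr ⟨c x, ?_⟩
      by_contra hvx
      refine (hv (c x)).1 ((Set.ncard_le_one (Set.toFinite _)).1 h _ ?_ _ ?_)
      · exact ⟨(hadj (c x) x ⟨hx, rfl⟩ (Ne.symm hvx)).symm, hvmax _ _ ⟨hx, rfl⟩ (Ne.symm hvx)⟩
      · exact ⟨(huniv (Ne.symm hx)).symm, hu x trivial hx⟩
    · rintro (rfl | ⟨i, rfl⟩)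
      · exact ((hup _).2 rfl).le.trans zero_le_one
      · refine (Set.ncard_le_one (Set.toFinite _)).2 ?_
        suffices h : ∀ w ∈ {w | G.Adj (v i) w ∧ Above G w (v i)}, w = u from
          fun a ha b hb => (h a ha).trans (h b hb).symm
        rintro w ⟨hw, hab⟩
        by_contra hwu
        refine (hvmax i w ⟨hwu, ?_⟩ hw.ne').asymm hab
        exact (hG.color _ _ hw (hv i).1 hwu).symm.trans (hv i).2
  unfold guardCount
  rw [hup1, ncard_insert_range hv]
  rcases hG.orientedMEternalNumber_eq_needsGuard hTP with ⟨h, h'⟩ | ⟨h, h'⟩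
  · have : {x | upCount G x = 0 ∧ NeedsGuard G x} = {u} := by
      ext x
      simp only [Set.mem_ofPred_eq, hup, Set.mem_singleton_iff]
      exact ⟨fun h => h.1, by rintro rfl; exact ⟨rfl, h⟩⟩
    rw [h', this, Set.ncard_singleton]
  · have : {x | upCount G x = 0 ∧ NeedsGuard G x} = ∅ := by
      ext x
      simp only [Set.mem_ofPred_eq, hup, Set.mem_empty_iff_false, iff_false]
      rintro ⟨rfl, h''⟩
      exact h h''
    rw [h', this, Set.ncard_empty]

/-- The oriented m-eternal domination number of a trivially perfect graph in terms of degrees. -/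
theorem orientedMEternalNumber_eq_guardCount [LinearOrder V] [Finite V]
    (hTP : IsTriviallyPerfect G) : orientedMEternalNumber G = guardCount G := by
  classical
  have := Fintype.ofFinite G.ConnectedComponent
  have hc : ∀ x y, G.Adj x y → G.connectedComponentMk x = G.connectedComponentMk y :=
    fun x y h => SimpleGraph.ConnectedComponent.connectedComponentMk_eq_of_adj h
  rw [orientedMEternalNumber_eq_sum _ hc, guardCount_eq_sum _ hc]
  exact Finset.sum_congr rfl fun i _ =>
    orientedMEternalNumber_eq_guardCount_of_connected i.connected_toSimpleGraph (hTP.induce _)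

end Formula

/-! ### Running programs -/

section Runs

variable {p q : Program} {s s' : State} {T T' : ℕ} {Q R : State → Prop} {x y a i c : ℕ}

@[simp] theorem State.reg_setReg (s : State) (x c y : ℕ) :
    (s.setReg x c).reg y = if y = x then c else s.reg y := by
  simp [State.setReg, Function.update_apply]

@[simp] theorem State.arr_setReg (s : State) (x c : ℕ) : (s.setReg x c).arr = s.arr := rfl

@[simp] theorem State.reg_setArr (s : State) (a i c : ℕ) : (s.setArr a i c).reg = s.reg := rfl

@[simp] theorem State.arr_setArr (s : State) (a i c b j : ℕ) :
    (s.setArr a i c).arr b j = if b = a ∧ j = i then c else s.arr b j := by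
  by_cases h : b = a
  · subst h
    simp [State.setArr, Function.update_apply]
  · simp [State.setArr, h]

/-- Started in the state `s`, the program `p` halts after at most `T` steps in a state that
satisfies `Q`. -/
def Runs (p : Program) (s : State) (T : ℕ) (Q : State → Prop) : Prop :=
  ∃ s' t, Exec p s s' t ∧ t ≤ T ∧ Q s'

theorem Runs.mono (h : Runs p s T R) (hT : T ≤ T') (hQ : ∀ s', R s' → Q s') : Runs p s T' Q := by
  obtain ⟨s', t, he, ht, hr⟩ := h
  exact ⟨s', t, he, ht.trans hT, hQ _ hr⟩

theorem Runs.seq (h : Runs p s T R) (h' : ∀ s', R s' → Runs q s' T' Q) :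
    Runs (.seq p q) s (T + T') Q := by
  obtain ⟨s₁, t₁, he₁, ht₁, hr⟩ := h
  obtain ⟨s₂, t₂, he₂, ht₂, hq⟩ := h' _ hr
  exact ⟨s₂, _, .seq he₁ he₂, Nat.add_le_add ht₁ ht₂, hq⟩

theorem Runs.ifLT (h : s.reg x < s.reg y → Runs p s T Q) (h' : ¬ s.reg x < s.reg y → Runs q s T Q) :
    Runs (.ifLT x y p q) s (T + 1) Q := by
  by_cases hc : s.reg x < s.reg y
  · obtain ⟨s', t, he, ht, hq⟩ := h hc
    exact ⟨s', _, .ifTrue hc he, by omega, hq⟩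
  · obtain ⟨s', t, he, ht, hq⟩ := h' hc
    exact ⟨s', _, .ifFalse hc he, by omega, hq⟩

theorem Runs.const (h : Q (s.setReg x c)) : Runs (.const x c) s 1 Q := ⟨_, _, .const s x c, le_rfl, h⟩

theorem Runs.copy (h : Q (s.setReg x (s.reg y))) : Runs (.copy x y) s 1 Q :=
  ⟨_, _, .copy s x y, le_rfl, h⟩

theorem Runs.incr (h : Q (s.setReg x (s.reg x + 1))) : Runs (.incr x) s 1 Q :=
  ⟨_, _, .incr s x, le_rfl, h⟩

theorem Runs.load (h : Q (s.setReg x (s.arr a (s.reg i)))) : Runs (.load x a i) s 1 Q :=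
  ⟨_, _, .load s x a i, le_rfl, h⟩

theorem Runs.store (h : Q (s.setArr a (s.reg i) (s.reg x))) : Runs (.store a i x) s 1 Q :=
  ⟨_, _, .store s a i x, le_rfl, h⟩

/-- The invariant is indexed by the number of completed rounds; each round pays one step for its
test, and the failing test costs the final one. -/
theorem Runs.whileLT {I : ℕ → State → Prop} {cost : ℕ → ℕ} {N : ℕ}
    (h : ∀ k < N, ∀ s, I k s → s.reg x < s.reg y ∧ Runs p s (cost k) (I (k + 1)))
    (hN : ∀ s, I N s → ¬ s.reg x < s.reg y) (h0 : I 0 s) :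
    Runs (.whileLT x y p) s (∑ k ∈ Finset.range N, (cost k + 1) + 1) (I N) := by
  suffices H : ∀ m k s, k + m = N → I k s →
      Runs (.whileLT x y p) s (∑ j ∈ Finset.range m, (cost (k + j) + 1) + 1) (I N) by
    simpa using H N 0 s (by omega) h0
  intro m
  induction m with
  | zero =>
    intro k s hk hs
    obtain rfl : k = N := hk
    exact ⟨s, 1, .whileFalse (hN s hs), by simp, hs⟩
  | succ m ih =>
    intro k s hk hs
    obtain ⟨hlt, s₁, t₁, he₁, ht₁, hs₁⟩ := h k (by omega) s hs
    obtain ⟨s₂, t₂, he₂, ht₂, hs₂⟩ := ih (k + 1) s₁ (by omega) hs₁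
    refine ⟨s₂, _, .whileTrue hlt he₁ he₂, ?_, hs₂⟩
    rw [Finset.sum_range_succ']
    simp only [Nat.add_zero, ← Nat.add_assoc] at ht₂ ⊢
    simp only [Nat.add_right_comm k 1] at ht₂
    omega

end Runs

/-! ### Loops over the neighbors of a vertex -/

section NeighborLoop

/-- No operation, in the shape of an assignment to the counter. -/
def skip : Program := .copy 10 10

/-- Count, in the register `10`, the neighbors of the vertex in the register `1` for which `body`
increments the counter. In `body` the register `13` holds the neighbor and the register `14` the
content of its cell in the array `2`. -/
def neighborLoop (body : Program) : Program :=
  .seq (.load 11 0 1) <| .seq (.copy 15 1) <| .seq (.incr 15) <| .seq (.load 12 0 15) <|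
  .seq (.const 10 0) <|
  .whileLT 11 12 (.seq (.load 13 1 11) <| .seq (.load 14 2 13) <| .seq body (.incr 11))

/-- The states agree except for the scratch registers from `10` on. -/
structure Agree (s s' : State) : Prop where
  arr : s'.arr = s.arr
  reg : ∀ x, x < 10 → s'.reg x = s.reg x

theorem Agree.refl (s : State) : Agree s s := ⟨rfl, fun _ _ => rfl⟩

theorem Agree.setReg {s s' : State} (h : Agree s s') {x : ℕ} (hx : 10 ≤ x) (c : ℕ) :
    Agree s (s'.setReg x c) :=
  ⟨h.arr, fun y hy => by
    rw [State.reg_setReg, if_neg (by omega)]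
    exact h.reg y hy⟩

/-- The number of entries in the list of the vertex `v` with property `P`. -/
def listCount (s : State) (v : ℕ) (P : ℕ → Prop) [DecidablePred P] : ℕ :=
  ∑ j ∈ Finset.range (s.arr 0 (v + 1) - s.arr 0 v), if P (s.arr 1 (s.arr 0 v + j)) then 1 else 0

/-- The length of the list of the vertex `v`. -/
def listLength (s : State) (v : ℕ) : ℕ := s.arr 0 (v + 1) - s.arr 0 v

/-- The constant 6 covers five assignments and the last test; each neighbor costs, besides `body`,
two loads, an increment and a test. -/
theorem runs_neighborLoop {body : Program} {s : State} {K : ℕ} (P : ℕ → Prop) [DecidablePred P]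
    (hle : s.arr 0 (s.reg 1) ≤ s.arr 0 (s.reg 1 + 1))
    (hbody : ∀ s₁, Agree s s₁ → s₁.reg 14 = s.arr 2 (s₁.reg 13) →
      Runs body s₁ K fun s₂ =>
        s₂ = s₁.setReg 10 (s₁.reg 10 + if P (s₁.reg 13) then 1 else 0)) :
    Runs (neighborLoop body) s (6 + (K + 4) * listLength s (s.reg 1)) fun s' =>
      Agree s s' ∧ s'.reg 10 = listCount s (s.reg 1) P := by
  have hA := Agree.refl s
  have key : ∀ s₁, Agree s s₁ → s₁.reg 11 = s.arr 0 (s.reg 1) →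
      s₁.reg 12 = s.arr 0 (s.reg 1 + 1) → s₁.reg 10 = 0 →
      Runs (.whileLT 11 12 (.seq (.load 13 1 11) <| .seq (.load 14 2 13) <| .seq body (.incr 11)))
        s₁ (∑ _k ∈ Finset.range (listLength s (s.reg 1)), (K + 3 + 1) + 1) fun s' =>
        Agree s s' ∧ s'.reg 11 = s.arr 0 (s.reg 1) + listLength s (s.reg 1) ∧
          s'.reg 12 = s.arr 0 (s.reg 1 + 1) ∧ s'.reg 10 = listCount s (s.reg 1) P := by
    intro s₁ h1 h2 h3 h4
    refine Runs.whileLT (I := fun k s' => Agree s s' ∧ s'.reg 11 = s.arr 0 (s.reg 1) + k ∧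
      s'.reg 12 = s.arr 0 (s.reg 1 + 1) ∧ s'.reg 10 =
        ∑ j ∈ Finset.range k, if P (s.arr 1 (s.arr 0 (s.reg 1) + j)) then 1 else 0)
      (cost := fun _ => K + 3) ?_ ?_ ⟨h1, h2, h3, by simpa using h4⟩
    · rintro k hk s' ⟨ha, h11, h12, h10⟩
      refine ⟨by unfold listLength at hk; omega, ?_⟩
      refine Runs.mono (T := 1 + (1 + (K + 1)))
        (Runs.seq (R := fun s₂ => s₂ = s'.setReg 13 (s.arr 1 (s.arr 0 (s.reg 1) + k))) (.load ?_)
        fun s₂ hs₂ => Runs.seq (R := fun s₃ => s₃ = s₂.setReg 14 (s.arr 2 (s₂.reg 13)))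
          (.load ?_) fun s₃ hs₃ => Runs.seq (hbody s₃ ?_ ?_) fun s₄ hs₄ => .incr ?_)
        (by omega) fun _ h => h
      · rw [ha.arr, h11]
      · rw [hs₂, State.arr_setReg, ha.arr]
      · rw [hs₃, hs₂]
        exact (ha.setReg (by omega) _).setReg (by omega) _
      · simp [hs₃]
      · subst hs₄ hs₃ hs₂
        refine ⟨(((ha.setReg (by omega) _).setReg (by omega) _).setReg (by omega) _).setReg
          (by omega) _, ?_, ?_, ?_⟩
        · simp [h11, add_assoc]
        · simp [h12]
        · rw [Finset.sum_range_succ, ← h10]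
          simp
    · rintro s' ⟨-, h11, h12, -⟩
      unfold listLength at h11
      omega
  refine Runs.mono (T := 1 + (1 + (1 + (1 + (1 +
    (∑ _k ∈ Finset.range (listLength s (s.reg 1)), (K + 3 + 1) + 1)))))) ?_ ?_
    fun s' (h : Agree s s' ∧ s'.reg 11 = s.arr 0 (s.reg 1) + listLength s (s.reg 1) ∧
          s'.reg 12 = s.arr 0 (s.reg 1 + 1) ∧ s'.reg 10 = listCount s (s.reg 1) P) =>
      ⟨h.1, h.2.2.2⟩
  · refine Runs.seq (R := fun s₁ => Agree s s₁ ∧ s₁.reg 11 = s.arr 0 (s.reg 1)) (.load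
      ⟨hA.setReg (by omega) _, by simp⟩) fun s₁ ⟨h1, h1'⟩ => ?_
    refine Runs.seq (R := fun s₂ => Agree s s₂ ∧ s₂.reg 11 = s.arr 0 (s.reg 1) ∧
      s₂.reg 15 = s.reg 1) (.copy ⟨h1.setReg (by omega) _, by simpa using h1', by
        simpa using h1.reg 1 (by omega)⟩) fun s₂ ⟨h2, h2', h2''⟩ => ?_
    refine Runs.seq (R := fun s₃ => Agree s s₃ ∧ s₃.reg 11 = s.arr 0 (s.reg 1) ∧
      s₃.reg 15 = s.reg 1 + 1) (.incr ⟨h2.setReg (by omega) _, by simpa using h2', by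
        simpa using h2''⟩) fun s₃ ⟨h3, h3', h3''⟩ => ?_
    refine Runs.seq (R := fun s₄ => Agree s s₄ ∧ s₄.reg 11 = s.arr 0 (s.reg 1) ∧
      s₄.reg 12 = s.arr 0 (s.reg 1 + 1)) (.load ⟨h3.setReg (by omega) _, by simpa using h3', by
        simp [h3'', h3.arr]⟩) fun s₄ ⟨h4, h4', h4''⟩ => ?_
    exact Runs.seq (R := fun s₅ => Agree s s₅ ∧ s₅.reg 11 = s.arr 0 (s.reg 1) ∧
      s₅.reg 12 = s.arr 0 (s.reg 1 + 1) ∧ s₅.reg 10 = 0) (.const ⟨h4.setReg (by omega) _, by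
        simpa using h4', by simpa using h4'', by simp⟩)
      fun s₅ ⟨h5, h5', h5'', h5'''⟩ => key s₅ h5 h5' h5'' h5'''
  · simp only [Finset.sum_const, Finset.card_range, smul_eq_mul]
    rw [mul_comm (K + 4), show K + 3 + 1 = K + 4 from rfl]
    omega

/-- The list of a vertex enumerates its neighbors. -/
theorem IsAdjacencyListInput.listCount_eq {n : ℕ} {G : SimpleGraph (Fin n)} {s : State}
    (hs : IsAdjacencyListInput G s) (v : Fin n) (P : ℕ → Prop) [DecidablePred P] :
    listCount s v P = {w : Fin n | G.Adj v w ∧ P w}.ncard := by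
  have hb := hs.neighbors v
  unfold listCount
  rw [← Finset.sum_Ico_eq_sum_range (fun j => if P (s.arr 1 j) then 1 else 0), Finset.sum_boole,
    Nat.cast_id, ← Set.ncard_coe_finset, ← Set.ncard_image_of_injective _ Fin.val_injective]
  have hinj : Set.InjOn (s.arr 1)
      ↑((Finset.Ico (s.arr 0 v) (s.arr 0 (v + 1))).filter fun j => P (s.arr 1 j)) :=
    hb.injOn.mono fun j hj => by simpa using (Finset.mem_filter.1 hj).1
  rw [← hinj.ncard_image]
  congr 1
  ext w
  constructor
  · rintro ⟨j, hj, rfl⟩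
    obtain ⟨hj, hP⟩ := Finset.mem_filter.1 hj
    obtain ⟨w, hw, hwj⟩ := hb.mapsTo (by simpa using hj)
    exact ⟨w, ⟨hw, by simpa [hwj] using hP⟩, hwj⟩
  · rintro ⟨w, ⟨hw, hP⟩, rfl⟩
    obtain ⟨j, hj, hjw⟩ := hb.surjOn ⟨w, hw, rfl⟩
    exact ⟨j, Finset.mem_coe.2 (Finset.mem_filter.2 ⟨by simpa using hj, by rwa [hjw]⟩), hjw⟩

theorem IsAdjacencyListInput.listLength_eq {n : ℕ} {G : SimpleGraph (Fin n)} {s : State}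
    (hs : IsAdjacencyListInput G s) (v : Fin n) : listLength s v = deg G v := by
  have := hs.listCount_eq v fun _ => True
  simpa [listCount, listLength, deg, SimpleGraph.neighborSet] using this

/-- Turns time linear in the degree at each vertex into total time linear in the number of edges. -/
theorem sum_deg {n : ℕ} (G : SimpleGraph (Fin n)) : ∑ v, deg G v = 2 * G.edgeSet.ncard := by
  classical
  have h := G.sum_degrees_eq_twice_card_edges
  rw [← SimpleGraph.coe_edgeFinset, Set.ncard_coe_finset, ← h]
  refine Finset.sum_congr rfl fun v _ => ?_
  rw [deg, ← Nat.card_coe_set_eq, Nat.card_eq_fintype_card, SimpleGraph.card_neighborSet_eq_degree]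

end NeighborLoop

/-! ### The linear time program -/

section Main

/-- Write the degrees of all vertices into the array `2`. -/
def degreeProgram : Program :=
  .seq (.const 1 0) <| .whileLT 1 0 <|
    .seq (neighborLoop (.incr 10)) <| .seq (.store 2 1 10) (.incr 1)

/-- Count the neighbors that precede the vertex in the order by decreasing degree. -/
def upBody : Program :=
  .ifLT 6 14 (.incr 10) (.ifLT 14 6 skip (.ifLT 13 1 (.incr 10) skip))

/-- Count the neighbors of degree at least two whose degree is not in the register `7`. -/
def exceptionBody : Program :=
  .ifLT 3 14 (.ifLT 14 7 (.incr 10) (.ifLT 7 14 (.incr 10) skip)) skip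

/-- Increment the answer if the vertex in the register `1` needs an additional guard. -/
def rootProgram : Program :=
  .seq (neighborLoop (.ifLT 3 14 (.incr 10) skip)) <| .seq (.copy 7 10) <|
  .seq (neighborLoop (.ifLT 4 14 (.incr 10) skip)) <| .seq (.copy 8 10) <|
  .seq (neighborLoop exceptionBody) <|
  .ifLT 2 8 (.ifLT 4 10 (.incr 5) skip) skip

/-- Add the contribution of the vertex in the register `1` to the answer. -/
def vertexProgram : Program :=
  .seq (.load 6 2 1) <| .seq (neighborLoop upBody) <| .seq (.copy 9 10) <|
  .seq (.ifLT 9 4 (.incr 5) skip) <| .ifLT 9 3 rootProgram skip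

/-- Compute the oriented m-eternal domination number of a trivially perfect graph. -/
def guardProgram : Program :=
  .seq degreeProgram <| .seq (.const 2 0) <| .seq (.const 3 1) <| .seq (.const 4 2) <|
  .seq (.const 5 0) <| .seq (.const 1 0) <|
  .seq (.whileLT 1 0 (.seq vertexProgram (.incr 1))) (.copy 0 5)

variable {n : ℕ} {G : SimpleGraph (Fin n)} {s₀ s : State}

theorem runs_incr_counter {s : State} {P : Prop} [Decidable P] (hP : P) :
    Runs (.incr 10) s 1 fun s' => s' = s.setReg 10 (s.reg 10 + if P then 1 else 0) :=
  .incr (by rw [if_pos hP])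

theorem runs_skip_counter {s : State} {P : Prop} [Decidable P] (hP : ¬ P) :
    Runs skip s 1 fun s' => s' = s.setReg 10 (s.reg 10 + if P then 1 else 0) :=
  .copy (by rw [if_neg hP, Nat.add_zero])

/-- The state contains the input and the degrees of all vertices. -/
structure Prepared (G : SimpleGraph (Fin n)) (s₀ s : State) : Prop where
  reg0 : s.reg 0 = n
  arr0 : s.arr 0 = s₀.arr 0
  arr1 : s.arr 1 = s₀.arr 1
  arr2 : ∀ v : Fin n, s.arr 2 v = deg G v

theorem Prepared.of_agree {s s' : State} (h : Prepared G s₀ s) (h' : Agree s s') :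
    Prepared G s₀ s' :=
  ⟨(h'.reg 0 (by omega)).trans h.reg0, by rw [h'.arr, h.arr0], by rw [h'.arr, h.arr1],
    by rw [h'.arr]; exact h.arr2⟩

theorem Prepared.setReg {s : State} (h : Prepared G s₀ s) {x : ℕ} (hx : x ≠ 0) (c : ℕ) :
    Prepared G s₀ (s.setReg x c) :=
  ⟨by simpa [hx.symm] using h.reg0, h.arr0, h.arr1, h.arr2⟩

/-- A loop over the neighbors of the vertex `v` counts the neighbors with the property `P`. -/
theorem Prepared.runs_neighborLoop (hs₀ : IsAdjacencyListInput G s₀) (h : Prepared G s₀ s)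
    {v : Fin n} (hv : s.reg 1 = v) {body : Program} {K : ℕ} (P : ℕ → Prop) [DecidablePred P]
    (hbody : ∀ s₁, Agree s s₁ → s₁.reg 14 = s.arr 2 (s₁.reg 13) →
      Runs body s₁ K fun s₂ => s₂ = s₁.setReg 10 (s₁.reg 10 + if P (s₁.reg 13) then 1 else 0)) :
    Runs (neighborLoop body) s (6 + (K + 4) * deg G v) fun s' =>
      Agree s s' ∧ s'.reg 10 = {w : Fin n | G.Adj v w ∧ P w}.ncard := by
  have h1 : listLength s v = deg G v := by
    rw [← hs₀.listLength_eq, listLength, listLength, h.arr0]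
  have h2 : listCount s v P = {w : Fin n | G.Adj v w ∧ P w}.ncard := by
    rw [← hs₀.listCount_eq, listCount, listCount, h.arr0, h.arr1]
  have h3 := EternalDomination.runs_neighborLoop P (s := s)
    (by rw [hv, h.arr0]; exact hs₀.offset_mono v) hbody
  rwa [hv, h1, h2] at h3

theorem runs_degreeProgram (hs₀ : IsAdjacencyListInput G s₀) :
    Runs degreeProgram s₀ (10 * n + 10 * G.edgeSet.ncard + 2) (Prepared G s₀) := by
  refine Runs.mono (T := 1 + (∑ k ∈ Finset.range n,
    ((6 + (1 + 4) * listLength s₀ k + (1 + 1)) + 1) + 1)) ?_ ?_ fun _ h => h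
  · refine Runs.seq (R := fun s => s = s₀.setReg 1 0) (.const rfl) ?_
    rintro _ rfl
    refine Runs.mono (Runs.whileLT (N := n) (I := fun k s => s.reg 0 = n ∧ s.reg 1 = k ∧
      s.arr 0 = s₀.arr 0 ∧ s.arr 1 = s₀.arr 1 ∧ ∀ v : Fin n, (v : ℕ) < k → s.arr 2 v = deg G v)
      ?_ ?_ ?_) le_rfl ?_
    · rintro k hk s ⟨h0, h1, ha0, ha1, ha2⟩
      refine ⟨by omega, ?_⟩
      -- The body does not read the register `14`, so the array `2` may still be incomplete.
      have hloop := runs_neighborLoop (body := .incr 10) (s := s) (K := 1) (fun _ => True)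
        (by rw [h1, ha0]; exact hs₀.offset_mono ⟨k, hk⟩)
        fun s₁ _ _ => runs_incr_counter trivial
      have hlen : listLength s (s.reg 1) = listLength s₀ k := by
        rw [listLength, listLength, h1, ha0]
      have hcount : listCount s (s.reg 1) (fun _ => True) = deg G ⟨k, hk⟩ := by
        rw [← hs₀.listLength_eq ⟨k, hk⟩, ← hlen]
        simp [listCount, listLength]
      rw [hlen, hcount] at hloop
      refine Runs.seq hloop fun s₁ ⟨hA, h10⟩ => ?_
      have hr1 : s₁.reg 1 = k := (hA.reg 1 (by omega)).trans h1
      have hr0 : s₁.reg 0 = n := (hA.reg 0 (by omega)).trans h0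
      refine Runs.mono (T := 1 + 1) (Runs.seq
        (R := fun s₂ => s₂ = s₁.setArr 2 k (deg G ⟨k, hk⟩)) (.store ?_) ?_) le_rfl fun _ h => h
      · rw [hr1, h10]
      · rintro _ rfl
        refine .incr ⟨by simpa using hr0, by simpa using hr1, ?_, ?_, fun v hv => ?_⟩
        · rw [State.arr_setReg]
          funext i
          simp [hA.arr, ha0]
        · rw [State.arr_setReg]
          funext i
          simp [hA.arr, ha1]
        · rw [State.arr_setReg, State.arr_setArr]
          by_cases hvk : (v : ℕ) = k
          · subst hvk
            simp
          · rw [if_neg (by tauto), hA.arr]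
            exact ha2 v (by omega)
    · rintro s ⟨h0, h1, -⟩
      omega
    · refine ⟨?_, by simp, rfl, rfl, fun v hv => absurd hv (by omega)⟩
      simpa using hs₀.order
    · rintro s ⟨h0, h1, ha0, ha1, ha2⟩
      exact ⟨h0, ha0, ha1, fun v => ha2 v v.2⟩
  · have h : ∑ k ∈ Finset.range n, listLength s₀ k = 2 * G.edgeSet.ncard := by
      rw [← sum_deg, Finset.sum_range]
      exact Finset.sum_congr rfl fun v _ => hs₀.listLength_eq v
    simp only [Finset.sum_add_distrib, ← Finset.mul_sum, h, Finset.sum_const, Finset.card_range,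
      smul_eq_mul]
    omega

open Classical in
/-- The contribution of a vertex to the answer. -/
noncomputable def contribution (G : SimpleGraph (Fin n)) (v : Fin n) : ℕ :=
  (if upCount G v ≤ 1 then 1 else 0) + if upCount G v = 0 ∧ NeedsGuard G v then 1 else 0

theorem sum_contribution (G : SimpleGraph (Fin n)) : ∑ v, contribution G v = guardCount G := by
  classical
  unfold contribution guardCount
  rw [Finset.sum_add_distrib, Finset.sum_boole, Finset.sum_boole, ← Set.ncard_coe_finset,
    ← Set.ncard_coe_finset]
  simp

/-- The registers between the contributions of two vertices. -/
structure Ready (G : SimpleGraph (Fin n)) (s₀ : State) (k r : ℕ) (s : State) : Prop where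
  prepared : Prepared G s₀ s
  reg1 : s.reg 1 = k
  reg2 : s.reg 2 = 0
  reg3 : s.reg 3 = 1
  reg4 : s.reg 4 = 2
  reg5 : s.reg 5 = r

theorem Ready.of_agree {s s' : State} {k r : ℕ} (h : Ready G s₀ k r s) (h' : Agree s s') :
    Ready G s₀ k r s' :=
  ⟨h.prepared.of_agree h', (h'.reg 1 (by omega)).trans h.reg1, (h'.reg 2 (by omega)).trans h.reg2,
    (h'.reg 3 (by omega)).trans h.reg3, (h'.reg 4 (by omega)).trans h.reg4,
    (h'.reg 5 (by omega)).trans h.reg5⟩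

theorem Ready.setReg {s : State} {k r : ℕ} (h : Ready G s₀ k r s) {x : ℕ} (hx : 6 ≤ x) (c : ℕ) :
    Ready G s₀ k r (s.setReg x c) := by
  refine ⟨h.prepared.setReg (by omega) c, ?_, ?_, ?_, ?_, ?_⟩ <;>
    rw [State.reg_setReg, if_neg (by omega)]
  exacts [h.reg1, h.reg2, h.reg3, h.reg4, h.reg5]

theorem Ready.incr {s : State} {k r r' : ℕ} (h : Ready G s₀ k r s) (hr : r' = r + 1) :
    Ready G s₀ k r' (s.setReg 5 (s.reg 5 + 1)) := by
  subst hr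
  exact ⟨h.prepared.setReg (by omega) _, by simp [h.reg1], by simp [h.reg2], by simp [h.reg3],
    by simp [h.reg4], by simp [h.reg5]⟩

theorem runs_skip_ready {s : State} {k r : ℕ} (h : Ready G s₀ k r s) :
    Runs skip s 1 (Ready G s₀ k r) :=
  .copy (h.setReg (by omega) _)

open Classical in
-- Three passes over the list compute the counts in `NeedsGuard`; the registers `2`, `3`, `4` hold
-- the constants 0, 1, 2 for the comparisons.
theorem runs_rootProgram (hs₀ : IsAdjacencyListInput G s₀) {v : Fin n} {r : ℕ}
    (h : Ready G s₀ v r s) :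
    Runs rootProgram s (30 + 22 * deg G v)
      (Ready G s₀ v (r + if NeedsGuard G v then 1 else 0)) := by
  have hset : ∀ k, {w : Fin n | G.Adj v w ∧ k < s.arr 2 w}.ncard = bigCount G (k + 1) v := by
    intro k
    simp only [h.prepared.arr2]
    rfl
  have hthreshold : ∀ (s₁ : State) (x k : ℕ), x < 10 → s₁.reg x = k → s₁.arr 2 = s.arr 2 →
      ∀ s₂, Agree s₁ s₂ → s₂.reg 14 = s₁.arr 2 (s₂.reg 13) →
      Runs (.ifLT x 14 (.incr 10) skip) s₂ 2 fun s₃ =>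
        s₃ = s₂.setReg 10 (s₂.reg 10 + if k < s.arr 2 (s₂.reg 13) then 1 else 0) := by
    intro s₁ x k hx hk ha s₂ hA h14
    have hx' : s₂.reg x = k := (hA.reg x hx).trans hk
    rw [ha] at h14
    rw [← hx', ← h14]
    exact .ifLT (fun h => runs_incr_counter h) fun h => runs_skip_counter h
  refine Runs.mono (T := 6 + (2 + 4) * deg G v + (1 + (6 + (2 + 4) * deg G v + (1 +
    (6 + (4 + 4) * deg G v + (1 + 1 + 1)))))) ?_ (by omega) fun _ h => h
  refine Runs.seq (h.prepared.runs_neighborLoop hs₀ h.reg1 (fun w => 1 < s.arr 2 w)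
    (hthreshold s 3 1 (by omega) h.reg3 rfl)) fun s₁ ⟨hA₁, hc₁⟩ => ?_
  rw [hset] at hc₁
  refine Runs.seq (R := fun s₂ => Ready G s₀ v r s₂ ∧ s₂.arr = s.arr ∧ s₂.reg 7 = bigCount G 2 v)
    (.copy ⟨(h.of_agree hA₁).setReg (by omega) _, by rw [State.arr_setReg, hA₁.arr],
      by simp [hc₁]⟩) fun s₂ ⟨h₂, ha₂, h7₂⟩ => ?_
  refine Runs.seq (h₂.prepared.runs_neighborLoop hs₀ h₂.reg1 (fun w => 2 < s.arr 2 w)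
    (hthreshold s₂ 4 2 (by omega) h₂.reg4 (by rw [ha₂]))) fun s₃ ⟨hA₃, hc₃⟩ => ?_
  rw [hset] at hc₃
  refine Runs.seq (R := fun s₄ => Ready G s₀ v r s₄ ∧ s₄.arr = s.arr ∧ s₄.reg 7 = bigCount G 2 v ∧
    s₄.reg 8 = bigCount G 3 v)
    (.copy ⟨(h₂.of_agree hA₃).setReg (by omega) _, by rw [State.arr_setReg, hA₃.arr, ha₂],
      by simp [hA₃.reg 7 (by omega), h7₂], by simp [hc₃]⟩) fun s₄ ⟨h₄, ha₄, h7₄, h8₄⟩ => ?_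
  refine Runs.seq (h₄.prepared.runs_neighborLoop hs₀ h₄.reg1
    (fun w => 2 ≤ s.arr 2 w ∧ s.arr 2 w ≠ bigCount G 2 v) (K := 4) fun s₅ hA₅ h14 => ?_)
    fun s₅ ⟨hA₅, hc₅⟩ => ?_
  · have h3 : s₅.reg 3 = 1 := (hA₅.reg 3 (by omega)).trans h₄.reg3
    have h7 : s₅.reg 7 = bigCount G 2 v := (hA₅.reg 7 (by omega)).trans h7₄
    rw [ha₄] at h14
    rw [← h14, ← h7]
    refine .ifLT (fun hc => .ifLT (fun hc' => (runs_incr_counter (by omega)).mono (by omega)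
      fun _ h => h) fun hc' => .ifLT (fun hc'' => runs_incr_counter (by omega))
      fun hc'' => runs_skip_counter (by omega)) fun hc =>
        (runs_skip_counter (by omega)).mono (by omega) fun _ h => h
  · have h₅ := h₄.of_agree hA₅
    have h8 : s₅.reg 8 = bigCount G 3 v := (hA₅.reg 8 (by omega)).trans h8₄
    have hN : NeedsGuard G v ↔ 1 ≤ s₅.reg 8 ∧ 3 ≤ s₅.reg 10 := by
      rw [h8, hc₅]
      simp only [h.prepared.arr2]
      rfl
    have h2 := h₅.reg2
    have h4 := h₅.reg4
    refine .ifLT (fun hc => .ifLT (fun hc' => .incr (h₅.incr ?_)) fun hc' => ?_) fun hc => ?_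
    · rw [if_pos (hN.2 (by omega))]
    · rw [if_neg fun h => by have := hN.1 h; omega]
      exact runs_skip_ready h₅
    · rw [if_neg fun h => by have := hN.1 h; omega]
      exact (runs_skip_ready h₅).mono (by omega) fun _ h => h

theorem runs_vertexProgram (hs₀ : IsAdjacencyListInput G s₀) {v : Fin n} {r : ℕ}
    (h : Ready G s₀ v r s) :
    Runs vertexProgram s (42 + 30 * deg G v) (Ready G s₀ v (r + contribution G v)) := by
  classical
  refine Runs.mono (T := 1 + (6 + (4 + 4) * deg G v + (1 + ((1 + 1) +
    (30 + 22 * deg G v + 1))))) ?_ (by omega) fun _ h => h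
  refine Runs.seq (R := fun s₁ => Ready G s₀ v r s₁ ∧ s₁.reg 6 = deg G v)
    (.load ⟨h.setReg (by omega) _, by simp [h.reg1, h.prepared.arr2]⟩) fun s₁ ⟨h₁, h6⟩ => ?_
  refine Runs.seq (h₁.prepared.runs_neighborLoop hs₀ h₁.reg1
    (fun w => deg G v < s₁.arr 2 w ∨ deg G v = s₁.arr 2 w ∧ w < v) (K := 4)
    fun s₂ hA₂ h14 => ?_) fun s₂ ⟨hA₂, hc₂⟩ => ?_
  · have h6' : s₂.reg 6 = deg G v := (hA₂.reg 6 (by omega)).trans h6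
    have h1' : s₂.reg 1 = v := (hA₂.reg 1 (by omega)).trans h₁.reg1
    rw [← h14, ← h6', ← h1']
    refine .ifLT (fun hc => (runs_incr_counter (by omega)).mono (by omega) fun _ h => h)
      fun hc => .ifLT (fun hc' => (runs_skip_counter (by omega)).mono (by omega) fun _ h => h)
        fun hc' => .ifLT (fun hc'' => runs_incr_counter (by omega))
          fun hc'' => runs_skip_counter (by omega)
  have hup : s₂.reg 10 = upCount G v := by
    rw [hc₂]
    simp only [h₁.prepared.arr2]
    rfl
  refine Runs.seq (R := fun s₃ => Ready G s₀ v r s₃ ∧ s₃.reg 9 = upCount G v)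
    (.copy ⟨(h₁.of_agree hA₂).setReg (by omega) _, by simp [hup]⟩) fun s₃ ⟨h₃, h9⟩ => ?_
  refine Runs.seq (R := fun s₄ => Ready G s₀ v (r + if upCount G v ≤ 1 then 1 else 0) s₄ ∧
    s₄.reg 9 = upCount G v) (.ifLT (fun hc => .incr ⟨h₃.incr ?_, by simp [h9]⟩)
      fun hc => .copy ⟨?_, by simp [h9]⟩) fun s₄ ⟨h₄, h9⟩ => ?_
  · rw [h9, h₃.reg4] at hc
    rw [if_pos (by omega)]
  · rw [h9, h₃.reg4] at hc
    rw [if_neg (by omega)]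
    exact h₃.setReg (by omega) _
  unfold contribution
  rw [← add_assoc]
  refine .ifLT (fun hc => ?_) fun hc => ?_
  · rw [h9, h₄.reg3] at hc
    have h0 : upCount G v = 0 := by omega
    refine (runs_rootProgram hs₀ h₄).mono le_rfl fun s' h' => ?_
    simp only [h0, true_and] at h' ⊢
    exact h'
  · rw [h9, h₄.reg3] at hc
    rw [if_neg (c := upCount G v = 0 ∧ NeedsGuard G v) (by omega), Nat.add_zero]
    exact (runs_skip_ready h₄).mono (by omega) fun _ h => h

theorem runs_guardProgram (hs₀ : IsAdjacencyListInput G s₀) :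
    Runs guardProgram s₀ (100 * (n + G.edgeSet.ncard + 1)) fun s => s.reg 0 = guardCount G := by
  -- Extension by zero to all natural numbers, to match the sums over the rounds of the loop.
  let g : ℕ → ℕ := fun k => if h : k < n then contribution G ⟨k, h⟩ else 0
  let d : ℕ → ℕ := fun k => if h : k < n then deg G ⟨k, h⟩ else 0
  have hd : ∑ k ∈ Finset.range n, d k = 2 * G.edgeSet.ncard := by
    rw [← sum_deg, Finset.sum_range]
    simp [d]
  have hg : ∑ k ∈ Finset.range n, g k = guardCount G := by
    rw [← sum_contribution, Finset.sum_range]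
    simp [g]
  refine Runs.mono (T := 10 * n + 10 * G.edgeSet.ncard + 2 + (1 + (1 + (1 + (1 + (1 +
    ((∑ k ∈ Finset.range n, ((42 + 30 * d k + 1) + 1) + 1) + 1))))))) ?_ ?_ fun _ h => h
  · refine Runs.seq (runs_degreeProgram hs₀) fun s₁ h₁ => ?_
    refine Runs.seq (R := fun s => Prepared G s₀ s ∧ s.reg 2 = 0)
      (.const ⟨h₁.setReg (by omega) _, by simp⟩) fun s₂ ⟨h₂, h2⟩ => ?_
    refine Runs.seq (R := fun s => Prepared G s₀ s ∧ s.reg 2 = 0 ∧ s.reg 3 = 1)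
      (.const ⟨h₂.setReg (by omega) _, by simp [h2]⟩) fun s₃ ⟨h₃, h2, h3⟩ => ?_
    refine Runs.seq (R := fun s => Prepared G s₀ s ∧ s.reg 2 = 0 ∧ s.reg 3 = 1 ∧ s.reg 4 = 2)
      (.const ⟨h₃.setReg (by omega) _, by simp [h2, h3]⟩) fun s₄ ⟨h₄, h2, h3, h4⟩ => ?_
    refine Runs.seq (R := fun s => Prepared G s₀ s ∧ s.reg 2 = 0 ∧ s.reg 3 = 1 ∧ s.reg 4 = 2 ∧
      s.reg 5 = 0)
      (.const ⟨h₄.setReg (by omega) _, by simp [h2, h3, h4]⟩) fun s₅ ⟨h₅, h2, h3, h4, h5⟩ => ?_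
    refine Runs.seq (R := fun s => Ready G s₀ 0 0 s)
      (.const ⟨h₅.setReg (by omega) _, by simp, by simp [h2], by simp [h3], by simp [h4],
        by simp [h5]⟩) fun s₆ h₆ => ?_
    refine Runs.seq (Runs.whileLT (N := n)
      (I := fun k s => Ready G s₀ k (∑ j ∈ Finset.range k, g j) s) ?_ ?_ (by simpa using h₆))
      fun s₇ h₇ => .copy (by simp [h₇.reg5, hg])
    · intro k hk s h
      refine ⟨by rw [h.reg1, h.prepared.reg0]; exact hk, ?_⟩
      have hdk : d k = deg G ⟨k, hk⟩ := dif_pos hk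
      have hgk : g k = contribution G ⟨k, hk⟩ := dif_pos hk
      rw [hdk]
      refine Runs.seq (runs_vertexProgram hs₀ (v := ⟨k, hk⟩) h) fun s' h' => .incr ?_
      rw [Finset.sum_range_succ, hgk]
      exact ⟨h'.prepared.setReg (by omega) _, by simp [h'.reg1], by simp [h'.reg2],
        by simp [h'.reg3], by simp [h'.reg4], by simp [h'.reg5]⟩
    · intro s h
      rw [h.reg1, h.prepared.reg0]
      omega
  · simp only [Finset.sum_add_distrib, ← Finset.mul_sum, hd, Finset.sum_const, Finset.card_range,
      smul_eq_mul]
    omega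

end Main

end EternalDomination

theorem mainTheorem6 :
    (∀ (V : Type*) [Finite V] (G : SimpleGraph V), 2 ≤ Nat.card V → G.Connected →
      EternalDomination.IsTriviallyPerfect G →
      ∀ l : ℕ, (EternalDomination.twoVertexConnectedComponents G).ncard = l →
        (∀ B ∈ EternalDomination.twoVertexConnectedComponents G, 3 ≤ B.ncard →
          (∀ B' ∈ EternalDomination.twoVertexConnectedComponents G, 3 ≤ B'.ncard → B' = B) →
          EternalDomination.orientedMEternalNumber G
              = EternalDomination.orientedMEternalNumber (G.induce B) + (l - 1) ∧
            EternalDomination.orientedMEternalNumber (G.induce B) ≤ 3) ∧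
        ((∀ B ∈ EternalDomination.twoVertexConnectedComponents G, B.ncard ≤ 3) →
          EternalDomination.orientedMEternalNumber G = l + 1) ∧
        ((∃ B ∈ EternalDomination.twoVertexConnectedComponents G,
            ∃ B' ∈ EternalDomination.twoVertexConnectedComponents G,
              B ≠ B' ∧ 4 ≤ B.ncard ∧ 3 ≤ B'.ncard) →
          EternalDomination.orientedMEternalNumber G = l + 2)) ∧
    EternalDomination.ComputableInLinearTimeOn
      (fun _ G => EternalDomination.IsTriviallyPerfect G)
      (fun _ G => EternalDomination.orientedMEternalNumber G) := by
  refine ⟨fun V _ G hV hc hTP l hl =>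
    EternalDomination.orientedMEternalNumber_of_connected hV hc hTP l hl,
    EternalDomination.guardProgram, 100, fun n G hTP s hs => ?_⟩
  obtain ⟨s', t, he, ht, h⟩ := EternalDomination.runs_guardProgram hs
  exact ⟨s', t, he, ht, h.trans (EternalDomination.orientedMEternalNumber_eq_guardCount hTP).symm⟩
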